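/- Let $\mathbb G=\mathbb G_-\cup\mathbb G_+$ with $\mathbb G_-=(-\infty,0-]$, $\mathbb G_+=[0+,\infty)$, be the real line with the point $0$ split into the two distinct points $0-$ and $0+$. Let $m,\lambda$ be fully supported Radon measures on $\mathbb G$ charging no singleton; they are also regarded as measures on $\mathbb R$, and $H:=L^2(\mathbb G,m)=L^2(\mathbb R,m)$. For a fully supported Radon measure $\nu$ without atoms, let $\mathtt s_\nu$ be its scale function, $\mathtt s_\nu(x)=\nu([0,x])$ for $x\ge 0$ and $\mathtt s_\nu(x)=-\nu([x,0])$ for $x<0$. For an interval $I$ and a function $f$ on $I$, $f\ll\nu$ on $I$ means $f=g\circ \mathtt s_\nu$ on $I$ with $g$ absolutely continuous on compact subintervals of $\mathtt s_\nu(I)$, and then $\frac{df}{d\nu}:=g'\circ\mathtt s_\nu$. For $I\in\{\mathbb R,\mathbb G_+,\mathbb G_-\}$ let $\mathscr F_{\nu,I}$ be the set of $f\in H$ whose restriction to $I$ has a version (still denoted $f$) with $f\ll\nu$ on $I$, $\int_I(\frac{df}{d\nu})^2d\nu<\infty$, $f(+\infty)=0$ if $\mathbb G_+\subset I$ and $\nu(\mathbb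 G_+)<\infty$, and $f(-\infty)=0$ if $\mathbb G_-\subset I$ and $\nu(\mathbb G_-)<\infty$ (for $I=\mathbb R$ read $\mathbb G_\pm$ as the half-lines of $\mathbb R$); and let $\mathscr E_{\nu,I}(f,g)=\frac12\int_I\frac{df}{d\nu}\frac{dg}{d\nu}\,d\nu$. Define the following forms on $H$. * Two-sided reflecting diffusion: $\mathscr F=\mathscr F_{\lambda,\mathbb G_+}\cap\mathscr F_{\lambda,\mathbb G_-}$, $\mathscr E=\mathscr E_{\lambda,\mathbb G_+}+\mathscr E_{\lambda,\mathbb G_-}$. * Snapping out diffusion with parameter $\kappa>0$: $\mathscr F^{\mathrm s}=\mathscr F$, $\mathscr E^{\mathrm s}(f,g)=\mathscr E(f,g)+\frac{\kappa}{4}(f(0+)-f(0-))(g(0+)-g(0-))$, where $f(0\pm)$ are the values at $0\pm$ of the continuous versions of $f$ on $\mathbb G_\pm$. * Irreducible diffusion on $\mathbb R$: $(\mathscr E^{\mathrm i},\mathscr F^{\mathrm i})=(\mathscr E_{\lambda,\mathbb R},\mathscr F_{\lambda,\mathbb R})$. Let $\varepsilon_n>0$ be a decreasing sequence with $\varepsilon_n\downarrow0$,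 and let $I_n=(-\varepsilon_n,\varepsilon_n)$. Let $T_{\varepsilon_n}:\mathbb G\to\mathbb R\setminus I_n$ be given by $x\mapsto x+\varepsilon_n$ on $\mathbb G_+$ and $x\mapsto x-\varepsilon_n$ on $\mathbb G_-$. For each $n$ let $\gamma_n$ be a finite, fully supported measure on $I_n$ charging no singleton, let $\lambda_n:=T_{\varepsilon_n}^{\#}\lambda+\gamma_n$, where $T^{\#}_{\varepsilon_n}\lambda$ is the image measure of $\lambda$ under $T_{\varepsilon_n}$, and let $(\mathscr E^n,\mathscr F^n)=(\mathscr E_{\lambda_n,\mathbb R},\mathscr F_{\lambda_n,\mathbb R})$. Set $\bar\gamma(n)=\gamma_n(I_n)$, $m^*(n)=\sup_{x\in\mathbb R}m([x,x+\varepsilon_n])$, $\lambda^*(n)=\sup_{x\in\mathbb R}\lambda([x,x+\varepsilon_n])$. Assume that $$\bar\gamma(n)\,m^*(n)+\lambda^*(n)\,m^*(n)\to0\quad(n\to\infty)$$ and that $\bar\gamma:=\lim_{n\to\infty}\bar\gamma(n)\in[0,\infty]$ exists. Then: 1. if $\bar\gamma=\infty$, $(\mathscr E^n,\mathscr F^n)$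 converges to $(\mathscr E,\mathscr F)$ in the sense of Mosco; 2. if $0<\bar\gamma<\infty$, $(\mathscr E^n,\mathscr F^n)$ converges to $(\mathscr E^{\mathrm s},\mathscr F^{\mathrm s})$ with $\kappa=2/\bar\gamma$ in the sense of Mosco; 3. if $\bar\gamma=0$, $(\mathscr E^n,\mathscr F^n)$ converges to $(\mathscr E^{\mathrm i},\mathscr F^{\mathrm i})$ in the sense of Mosco. Here forms are extended by $\mathscr E(u,u):=\infty$ for $u\in H$ outside the domain, and $(\mathscr E^n,\mathscr F^n)$ converges to $(\mathscr E',\mathscr F')$ in the sense of Mosco if (a) $\mathscr E'(u,u)\le\liminf_n\mathscr E^n(u_n,u_n)$ whenever $u_n\to u$ weakly in $H$, and (b) for every $u\in H$ there are $u_n\to u$ strongly in $H$ with $\limsup_n\mathscr E^n(u_n,u_n)\le\mathscr E'(u,u)$. -/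

import Mathlib

open MeasureTheory Filter Topology Set
open scoped ENNReal

noncomputable section

namespace StiffProblem

/-! ### Symmetric forms on a Hilbert space and Mosco convergence -/

/-- A nonnegative symmetric form on `H` given by its domain and its values on the domain. -/
structure SymForm (H : Type*) where
  /-- the domain of the form -/
  domain : Set H
  /-- the value of the form at a pair of elements of the domain (elsewhere irrelevant) -/
  form : H → H → ℝ
  symm : ∀ u ∈ domain, ∀ v ∈ domain, form u v = form v u
  nonneg : ∀ u ∈ domain, 0 ≤ form u u

open Classical in
/-- The diagonal `u ↦ E(u,u)` extended by `∞` outside the domain. -/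
def SymForm.energy {H : Type*} (E : SymForm H) (u : H) : ℝ≥0∞ :=
  if u ∈ E.domain then ENNReal.ofReal (E.form u u) else ⊤

/-- Mosco convergence of a sequence of forms on a common Hilbert space. -/
def MoscoConverges {H : Type*} [NormedAddCommGroup H] [InnerProductSpace ℝ H]
    (En : ℕ → SymForm H) (E : SymForm H) : Prop :=
  (∀ (u : ℕ → H) (v : H),
      (∀ w : H, Tendsto (fun n => inner ℝ (u n) w) atTop (𝓝 (inner ℝ v w))) →
      E.energy v ≤ liminf (fun n => (En n).energy (u n)) atTop) ∧
  (∀ v : H, ∃ u : ℕ → H, Tendsto u atTop (𝓝 v) ∧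
      limsup (fun n => (En n).energy (u n)) atTop ≤ E.energy v)

/-! ### Scale functions and absolute continuity with respect to a measure

The space `𝔾 = (-∞,0-] ∪ [0+,∞)` differs from `ℝ` only by doubling the point `0`. A Radon measure
without atoms on `𝔾` is the same thing as a Radon measure without atoms on `ℝ`, and the two `L²`
spaces coincide, so all measures live on `ℝ`; the two half-lines `𝔾₊`, `𝔾₋` are `Ici 0`, `Iic 0`,
and a function on `𝔾` is a pair of functions, one on `Ici 0` and one on `Iic 0`. -/

/-- A fully supported Radon measure which charges no singleton. -/
structure IsAdmissible (ν : Measure ℝ) : Prop where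
  locallyFinite : IsLocallyFiniteMeasure ν
  fullSupport : ν.IsOpenPosMeasure
  noAtoms : ∀ x : ℝ, ν {x} = 0

/-- The scale function induced by `ν`, normalised to vanish at `0`. -/
def scaleFn (ν : Measure ℝ) (x : ℝ) : ℝ :=
  if 0 ≤ x then (ν (Icc 0 x)).toReal else -(ν (Icc x 0)).toReal

/-- On the interval `I`, `u = g ∘ s` where `s` is the scale function of `ν` and `g` is absolutely
continuous on every compact interval contained in `s(I)`. -/
def IsScaleFactor (ν : Measure ℝ) (I : Set ℝ) (u g : ℝ → ℝ) : Prop :=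
  (∀ a ∈ scaleFn ν '' I, ∀ b ∈ scaleFn ν '' I, AbsolutelyContinuousOnInterval g a b) ∧
  ∀ x ∈ I, u x = g (scaleFn ν x)

/-- `u ≪ ν` on the interval `I`. -/
def AbsContWrt (ν : Measure ℝ) (I : Set ℝ) (u : ℝ → ℝ) : Prop :=
  ∃ g : ℝ → ℝ, IsScaleFactor ν I u g

open Classical in
/-- The derivative `du/dν = g' ∘ s` on `I`, where `u = g ∘ s` (and `0` if `u ≪ ν` fails). The
factor `g` is determined by `u` on `s(I)`, hence `du/dν` is determined at all interior points
of `I`. -/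
def scaleDeriv (ν : Measure ℝ) (I : Set ℝ) (u : ℝ → ℝ) (x : ℝ) : ℝ :=
  if h : AbsContWrt ν I u then deriv h.choose (scaleFn ν x) else 0

variable (m ν : Measure ℝ)

/-- `u` is a `ν`-absolutely continuous version on `I` of the class `f`. -/
def IsVersion (I : Set ℝ) (f : Lp ℝ 2 m) (u : ℝ → ℝ) : Prop :=
  AbsContWrt ν I u ∧ f =ᵐ[m.restrict I] u

open Classical in
/-- The `ν`-absolutely continuous version of `f` on `I`; it is unique on the interval `I` if `m`
is fully supported (outside `I`, and if there is no such version, the value is irrelevant). -/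
def version (I : Set ℝ) (f : Lp ℝ 2 m) : ℝ → ℝ :=
  if h : ∃ u, IsVersion m ν I f u then h.choose else 0

/-- The domain of the diffusion form on `I`, for `I` one of `ℝ`, `[0,∞)`, `(-∞,0]`: the classes
having a version `u ≪ ν` on `I` with `∫_I (du/dν)² dν < ∞` and `u(±∞) = 0` for each infinite end
of `I` of finite `ν`-length. -/
def diffusionDomain (I : Set ℝ) : Set (Lp ℝ 2 m) :=
  {f | ∃ u, IsVersion m ν I f u ∧
    IntegrableOn (fun x => scaleDeriv ν I u x ^ 2) I ν ∧
    (Ici 0 ⊆ I → ν (Ici 0) < ⊤ → Tendsto u atTop (𝓝 0)) ∧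
    (Iic 0 ⊆ I → ν (Iic 0) < ⊤ → Tendsto u atBot (𝓝 0))}

/-- The energy integral `(1/2) ∫_I (df/dν) (dg/dν) dν`. -/
def diffusionEnergy (I : Set ℝ) (f g : Lp ℝ 2 m) : ℝ :=
  (1 / 2) * ∫ x in I, scaleDeriv ν I (version m ν I f) x * scaleDeriv ν I (version m ν I g) x ∂ν

theorem diffusionEnergy_comm (I : Set ℝ) (f g : Lp ℝ 2 m) :
    diffusionEnergy m ν I f g = diffusionEnergy m ν I g f := by
  simp only [diffusionEnergy, mul_comm]

theorem diffusionEnergy_self_nonneg (I : Set ℝ) (f : Lp ℝ 2 m) :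
    0 ≤ diffusionEnergy m ν I f f :=
  mul_nonneg (by norm_num) (integral_nonneg fun _ => mul_self_nonneg _)

/-- The form of the irreducible diffusion on `ℝ` with speed measure `m` and the scale function
induced by `ν`. -/
def irreducibleForm : SymForm (Lp ℝ 2 m) where
  domain := diffusionDomain m ν univ
  form := diffusionEnergy m ν univ
  symm u _ v _ := diffusionEnergy_comm m ν univ u v
  nonneg u _ := diffusionEnergy_self_nonneg m ν univ u

/-- The form of the two-sided reflecting diffusion on `𝔾`: the direct sum of the forms of the
reflecting diffusions on the two half-lines. -/
def reflectingForm : SymForm (Lp ℝ 2 m) where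
  domain := diffusionDomain m ν (Ici 0) ∩ diffusionDomain m ν (Iic 0)
  form f g := diffusionEnergy m ν (Ici 0) f g + diffusionEnergy m ν (Iic 0) f g
  symm u _ v _ := by
    simp only [diffusionEnergy_comm m ν _ u v]
  nonneg u _ := add_nonneg (diffusionEnergy_self_nonneg m ν _ u)
    (diffusionEnergy_self_nonneg m ν _ u)

/-- The jump `f(0+) - f(0-)`, computed from the continuous versions on the two half-lines. -/
def jump (f : Lp ℝ 2 m) : ℝ :=
  version m ν (Ici 0) f 0 - version m ν (Iic 0) f 0

/-- The form of the snapping out diffusion on `𝔾` with parameter `κ`. -/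
def snappingOutForm (κ : ℝ) (hκ : 0 ≤ κ) : SymForm (Lp ℝ 2 m) where
  domain := (reflectingForm m ν).domain
  form f g := (reflectingForm m ν).form f g + κ / 4 * (jump m ν f * jump m ν g)
  symm u hu v hv := by
    rw [(reflectingForm m ν).symm u hu v hv, mul_comm (jump m ν u)]
  nonneg u hu := add_nonneg ((reflectingForm m ν).nonneg u hu)
    (mul_nonneg (by positivity) (mul_self_nonneg _))

end StiffProblem

/-! ### The barrier -/

namespace StiffProblem

/-- The map `T_ε` which moves `[0+,∞)` onto `[ε,∞)` and `(-∞,0-]` onto `(-∞,-ε]` by translations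
(the point `0` is a null set for the measures considered). -/
def spread (ε x : ℝ) : ℝ := if 0 ≤ x then x + ε else x - ε

/-- A barrier: a finite measure on `(-ε,ε)`, fully supported there and charging no singleton
(regarded as a measure on `ℝ` which vanishes outside `(-ε,ε)`). -/
structure IsBarrier (ε : ℝ) (γ : Measure ℝ) : Prop where
  finite : IsFiniteMeasure γ
  null_compl : γ (Ioo (-ε) ε)ᶜ = 0
  fullSupport : ∀ U : Set ℝ, IsOpen U → U ⊆ Ioo (-ε) ε → U.Nonempty → 0 < γ U
  noAtoms : ∀ x : ℝ, γ {x} = 0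

/-- The thermal resistance with barrier: the image of `ν` under `T_ε` plus `γ`. -/
def barrierResistance (ν : Measure ℝ) (ε : ℝ) (γ : Measure ℝ) : Measure ℝ :=
  ν.map (spread ε) + γ

/-- The supremum over `x ∈ ℝ` of `ν([x, x + ε])`. -/
def supMass (ν : Measure ℝ) (ε : ℝ) : ℝ≥0∞ := ⨆ x : ℝ, ν (Icc x (x + ε))

end StiffProblem

end

/-! A function of finite energy is a constant plus the `ν`-primitive of a square integrable density,
and its energy is half the squared L² norm of that density. For the resistance with barrier, L²
splits as L²(λ) ⊕ L²(γ_n): a density h becomes H = h ∘ `spread` together with h on the barrier, and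
the energy is ½(∫ H² dλ + ∫ h² dγ_n). The increment across the barrier is J = ∫ h dγ_n, so
Cauchy–Schwarz gives ∫ h² dγ_n ≥ J² / γ_n(I_n), with equality for constant h. In the limit a jump J
therefore costs J² / (2γ̄): nothing if γ̄ = ∞, (κ/4) J² with κ = 2/γ̄ if 0 < γ̄ < ∞, and J = 0 is
forced if γ̄ = 0.

Lower bound (`exists_splitRep_of_weak`): bounded energies make the pulled-back densities weakly
precompact in L²(λ). On each open half-line the functions minus their values at ±ε_n then converge
pointwise with local bounds, and the weak convergence of the functions themselves forces the values
at ±ε_n to converge (`exists_tendsto_const_of_weak`).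

Recovery (`exists_tendsto_of_splitRep`): the two halves of the target are moved apart and joined by
a constant density on the barrier, so the energy is explicit. The L² error comes from a shift by
ε_n, bounded by λ*(n) m*(n) through Tonelli (`lintegral_sq_increment_le`), and from a bounded
function on the shrinking interval [-ε_n, ε_n]. -/

namespace StiffProblem

/-! ### Change of variables by the scale function, and primitives with respect to a measure -/

section Scale

variable {ν : Measure ℝ}

theorem IsAdmissible.isNullSingletonClass (hν : IsAdmissible ν) : NullSingletonClass ν :=
  ⟨hν.noAtoms⟩

theorem scaleFn_sub (hν : IsAdmissible ν) {a b : ℝ} (hab : a ≤ b) :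
    scaleFn ν b - scaleFn ν a = (ν (Ioc a b)).toReal := by
  have := hν.locallyFinite
  have := hν.isNullSingletonClass
  have key : ∀ {x y z : ℝ}, x ≤ y → y ≤ z →
      (ν (Ioc x z)).toReal = (ν (Ioc x y)).toReal + (ν (Ioc y z)).toReal := by
    intro x y z hxy hyz
    rw [← Ioc_union_Ioc_eq_Ioc hxy hyz, measure_union (by
      rw [Set.disjoint_left]; rintro t ⟨_, h1⟩ ⟨h2, _⟩; linarith) measurableSet_Ioc,
      ENNReal.toReal_add measure_Ioc_lt_top.ne measure_Ioc_lt_top.ne]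
  simp only [scaleFn, measure_congr (Ioc_ae_eq_Icc (μ := ν)).symm]
  split_ifs with hb ha ha
  · have := key ha hab; linarith
  · have := key (not_le.1 ha).le hb; linarith
  · linarith
  · have := key hab (not_le.1 hb).le; linarith

theorem scaleFn_zero (hν : IsAdmissible ν) : scaleFn ν 0 = 0 := by
  simp [scaleFn, hν.noAtoms]

theorem strictMono_scaleFn (hν : IsAdmissible ν) : StrictMono (scaleFn ν) := by
  intro a b hab
  have := hν.locallyFinite
  have := hν.fullSupport
  have h := scaleFn_sub hν hab.le
  have h2 : 0 < (ν (Ioc a b)).toReal := by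
    refine ENNReal.toReal_pos ?_ measure_Ioc_lt_top.ne
    exact ((isOpen_Ioo.measure_pos ν (nonempty_Ioo.2 hab)).trans_le
      (measure_mono Ioo_subset_Ioc_self)).ne'
  linarith

theorem measure_Ioc_eq_ofReal (hν : IsAdmissible ν) {a b : ℝ} (hab : a ≤ b) :
    ν (Ioc a b) = ENNReal.ofReal (scaleFn ν b - scaleFn ν a) := by
  have := hν.locallyFinite
  rw [scaleFn_sub hν hab, ENNReal.ofReal_toReal measure_Ioc_lt_top.ne]

theorem continuous_scaleFn (hν : IsAdmissible ν) : Continuous (scaleFn ν) := by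
  have := hν.locallyFinite
  have := hν.isNullSingletonClass
  have h := intervalIntegral.continuous_primitive (μ := ν) (f := fun _ => (1 : ℝ))
    (fun a b => intervalIntegrable_const) 0
  refine h.congr fun x => ?_
  rcases le_total 0 x with hx | hx
  · rw [intervalIntegral.integral_of_le hx]
    have := scaleFn_sub hν hx
    rw [scaleFn_zero hν, sub_zero] at this
    simp [this, Measure.real]
  · rw [intervalIntegral.integral_of_ge hx]
    have := scaleFn_sub hν hx
    rw [scaleFn_zero hν, zero_sub] at this
    simp [← this, Measure.real]

theorem measurableEmbedding_scaleFn (hν : IsAdmissible ν) : MeasurableEmbedding (scaleFn ν) :=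
  (continuous_scaleFn hν).measurableEmbedding (strictMono_scaleFn hν).injective

/-- In the scale coordinate `ν` is Lebesgue measure. Two finite measures agree once they agree on
all half-lines, and there both sides are increments of the scale function. -/
theorem map_scaleFn_restrict_Ioc (hν : IsAdmissible ν) {a b : ℝ} (hab : a ≤ b) :
    (ν.restrict (Ioc a b)).map (scaleFn ν) =
      volume.restrict (Ioc (scaleFn ν a) (scaleFn ν b)) := by
  have := hν.locallyFinite
  have hs := strictMono_scaleFn hν
  have hc := continuous_scaleFn hν
  have : IsFiniteMeasure (ν.restrict (Ioc a b)) := ⟨by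
    rw [Measure.restrict_apply_univ]; exact measure_Ioc_lt_top⟩
  refine Measure.ext_of_Iic _ _ fun t => ?_
  rw [Measure.map_apply hc.measurable measurableSet_Iic, Measure.restrict_apply
    (hc.measurable measurableSet_Iic), Measure.restrict_apply measurableSet_Iic]
  have hR : Iic t ∩ Ioc (scaleFn ν a) (scaleFn ν b) =
      Ioc (scaleFn ν a) (min (scaleFn ν b) t) := by
    ext x; simp only [mem_inter_iff, mem_Iic, mem_Ioc, le_min_iff]; tauto
  rw [hR, Real.volume_Ioc]
  rcases lt_or_ge t (scaleFn ν a) with h1 | h1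
  · rw [min_eq_right (h1.le.trans (hs.monotone hab)), ENNReal.ofReal_of_nonpos (by linarith)]
    convert measure_empty (μ := ν)
    ext x
    simp only [mem_inter_iff, mem_preimage, mem_Iic, mem_Ioc, mem_empty_iff_false, iff_false]
    rintro ⟨h2, h3, -⟩
    have := hs h3
    linarith
  rcases le_total (scaleFn ν b) t with h2 | h2
  · rw [min_eq_left h2, ← measure_Ioc_eq_ofReal hν hab]
    congr 1
    refine inter_eq_right.2 fun x hx => ?_
    exact (hs.monotone hx.2).trans h2
  · obtain ⟨τ, hτ, rfl⟩ := intermediate_value_Icc hab hc.continuousOn ⟨h1, h2⟩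
    rw [min_eq_right h2, ← measure_Ioc_eq_ofReal hν hτ.1]
    congr 1
    ext x
    simp only [mem_inter_iff, mem_preimage, mem_Iic, mem_Ioc, hs.le_iff_le]
    exact ⟨fun h => ⟨h.2.1, h.1⟩, fun h => ⟨h.2, h.1, h.2.trans hτ.2⟩⟩

theorem integrableOn_comp_scaleFn_iff (hν : IsAdmissible ν) (k : ℝ → ℝ) {a b : ℝ} (hab : a ≤ b) :
    IntegrableOn k (Ioc (scaleFn ν a) (scaleFn ν b)) ↔
      IntegrableOn (fun x => k (scaleFn ν x)) (Ioc a b) ν := by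
  rw [IntegrableOn, ← map_scaleFn_restrict_Ioc hν hab,
    (measurableEmbedding_scaleFn hν).integrable_map_iff]
  rfl

theorem intervalIntegrable_comp_scaleFn_iff (hν : IsAdmissible ν) (k : ℝ → ℝ) (a b : ℝ) :
    IntervalIntegrable k volume (scaleFn ν a) (scaleFn ν b) ↔
      IntervalIntegrable (fun x => k (scaleFn ν x)) ν a b := by
  wlog hab : a ≤ b generalizing a b
  · rw [IntervalIntegrable.symm_iff, this b a (le_of_not_ge hab), IntervalIntegrable.symm_iff]
  rw [intervalIntegrable_iff_integrableOn_Ioc_of_le hab,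
    intervalIntegrable_iff_integrableOn_Ioc_of_le ((strictMono_scaleFn hν).monotone hab),
    integrableOn_comp_scaleFn_iff hν k hab]

theorem intervalIntegral_comp_scaleFn (hν : IsAdmissible ν) (k : ℝ → ℝ) (a b : ℝ) :
    ∫ x in a..b, k (scaleFn ν x) ∂ν = ∫ t in scaleFn ν a..scaleFn ν b, k t := by
  wlog hab : a ≤ b generalizing a b
  · rw [intervalIntegral.integral_symm, this b a (le_of_not_ge hab),
      ← intervalIntegral.integral_symm]
  rw [intervalIntegral.integral_of_le hab,
    intervalIntegral.integral_of_le ((strictMono_scaleFn hν).monotone hab),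
    ← map_scaleFn_restrict_Ioc hν hab, (measurableEmbedding_scaleFn hν).integral_map]

/-- `u` is a primitive of `h` on `I` with respect to `ν`. -/
def IsPrimitive (ν : Measure ℝ) (I : Set ℝ) (u h : ℝ → ℝ) : Prop :=
  ∀ a ∈ I, ∀ b ∈ I, IntervalIntegrable h ν a b ∧ ∫ x in a..b, h x ∂ν = u b - u a

/-- Together with `IsPrimitive.isScaleFactor` this replaces the factor `g` by an integral identity
against `ν`, which is easier to restrict, glue and pass to limits. -/
theorem IsScaleFactor.isPrimitive (hν : IsAdmissible ν) {I : Set ℝ} {u g : ℝ → ℝ}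
    (hg : IsScaleFactor ν I u g) : IsPrimitive ν I u (fun x => deriv g (scaleFn ν x)) := by
  intro a ha b hb
  have h := hg.1 _ (mem_image_of_mem _ ha) _ (mem_image_of_mem _ hb)
  refine ⟨(intervalIntegrable_comp_scaleFn_iff hν _ _ _).1 h.intervalIntegrable_deriv, ?_⟩
  rw [intervalIntegral_comp_scaleFn hν, h.integral_deriv_eq_sub, ← hg.2 a ha, ← hg.2 b hb]

theorem AbsContWrt.isPrimitive (hν : IsAdmissible ν) {I : Set ℝ} {u : ℝ → ℝ}
    (h : AbsContWrt ν I u) : IsPrimitive ν I u (scaleDeriv ν I u) := by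
  have := h.choose_spec.isPrimitive hν
  convert this using 2 with x
  simp [scaleDeriv, h]

theorem measurable_scaleDeriv (hν : IsAdmissible ν) (I : Set ℝ) (u : ℝ → ℝ) :
    Measurable (scaleDeriv ν I u) := by
  by_cases h : AbsContWrt ν I u
  · have : scaleDeriv ν I u = fun x => deriv h.choose (scaleFn ν x) := by
      ext x; simp [scaleDeriv, h]
    rw [this]
    exact (measurable_deriv _).comp (continuous_scaleFn hν).measurable
  · have : scaleDeriv ν I u = fun _ => 0 := by
      ext x; simp [scaleDeriv, h]
    rw [this]
    exact measurable_const

theorem exists_Icc_mem_nhdsWithin {I : Set ℝ} {x : ℝ} (hx : x ∈ I) :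
    ∃ a ∈ I, ∃ b ∈ I, a ≤ x ∧ x ≤ b ∧ Icc a b ∈ 𝓝[I] x := by
  obtain ⟨a, ha, hax, haI⟩ : ∃ a ∈ I, a ≤ x ∧ Ici a ∈ 𝓝[I] x := by
    by_cases h : ∃ y ∈ I, y < x
    · obtain ⟨y, hy, hyx⟩ := h
      exact ⟨y, hy, hyx.le, mem_nhdsWithin_of_mem_nhds (Ici_mem_nhds hyx)⟩
    · push Not at h
      exact ⟨x, hx, le_rfl, mem_of_superset self_mem_nhdsWithin h⟩
  obtain ⟨b, hb, hbx, hbI⟩ : ∃ b ∈ I, x ≤ b ∧ Iic b ∈ 𝓝[I] x := by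
    by_cases h : ∃ y ∈ I, x < y
    · obtain ⟨y, hy, hyx⟩ := h
      exact ⟨y, hy, hyx.le, mem_nhdsWithin_of_mem_nhds (Iic_mem_nhds hyx)⟩
    · push Not at h
      exact ⟨x, hx, le_rfl, mem_of_superset self_mem_nhdsWithin h⟩
  refine ⟨a, ha, b, hb, hax, hbx, ?_⟩
  rw [← Ici_inter_Iic]
  exact inter_mem haI hbI

theorem IsPrimitive.continuousOn (hν : IsAdmissible ν) {I : Set ℝ} {u h : ℝ → ℝ}
    (hu : IsPrimitive ν I u h) (hI : I.OrdConnected) : ContinuousOn u I := by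
  have := hν.isNullSingletonClass
  intro x hx
  obtain ⟨a, ha, b, hb, hax, hbx, h1⟩ := exists_Icc_mem_nhdsWithin hx
  have hc := intervalIntegral.continuousOn_primitive_interval' (hu a ha b hb).1 left_mem_uIcc
  rw [uIcc_of_le (hax.trans hbx)] at hc
  have h2 : ContinuousOn u (Icc a b) := by
    refine (hc.add (continuousOn_const (c := u a))).congr fun y hy => ?_
    have := (hu a ha y (hI.out ha hb hy)).2
    simp only [Pi.add_apply, this]; ring
  exact (h2 x ⟨hax, hbx⟩).mono_of_mem_nhdsWithin h1

/-- A locally null set is null. The absence of atoms allows closed intervals in place of half-open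
ones, so that endpoints belonging to `I` are covered. -/
theorem ae_restrict_of_forall_Ioc {μ : Measure ℝ} [NullSingletonClass μ] {I : Set ℝ}
    (hI : I.OrdConnected) {p : ℝ → Prop}
    (h : ∀ a ∈ I, ∀ b ∈ I, a ≤ b → ∀ᵐ x ∂μ.restrict (Ioc a b), p x) :
    ∀ᵐ x ∂μ.restrict I, p x := by
  rw [ae_restrict_iff' hI.measurableSet]
  refine measure_null_of_locally_null _ fun x hx => ?_
  have hxI : x ∈ I := by
    by_contra hn; exact hx fun h => (hn h).elim
  set J : Set ℝ := {x | x ∈ I → p x}ᶜ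
  have hJI : J ⊆ I := by
    intro y hy; by_contra hn; exact hy fun h => (hn h).elim
  obtain ⟨a, ha, b, hb, hax, hbx, hab⟩ := exists_Icc_mem_nhdsWithin hxI
  refine ⟨J ∩ Icc a b, inter_mem self_mem_nhdsWithin (nhdsWithin_mono _ hJI hab), ?_⟩
  have h1 := h a ha b hb (hax.trans hbx)
  rw [restrict_Ioc_eq_restrict_Icc, ae_restrict_iff' measurableSet_Icc] at h1
  refine measure_mono_null ?_ h1
  rintro y ⟨hy, hy2⟩ hn
  exact hy fun _ => hn hy2

theorem IsPrimitive.isScaleFactor (hν : IsAdmissible ν) {I : Set ℝ} (hI : I.OrdConnected)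
    {u h : ℝ → ℝ} (hu : IsPrimitive ν I u h) :
    IsScaleFactor ν I u (u ∘ Function.invFun (scaleFn ν)) := by
  have hs := strictMono_scaleFn hν
  have hinv : ∀ x, Function.invFun (scaleFn ν) (scaleFn ν x) = x :=
    Function.leftInverse_invFun hs.injective
  refine ⟨?_, fun x _ => by simp [hinv]⟩
  rintro _ ⟨a, ha, rfl⟩ _ ⟨b, hb, rfl⟩
  wlog hab : a ≤ b generalizing a b
  · exact (this b hb a ha (le_of_not_ge hab)).symm
  have hk : IntervalIntegrable (fun t => h (Function.invFun (scaleFn ν) t)) volume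
      (scaleFn ν a) (scaleFn ν b) := by
    rw [intervalIntegrable_comp_scaleFn_iff hν]
    simpa only [hinv] using (hu a ha b hb).1
  have hac := hk.absolutelyContinuousOnInterval_intervalIntegral (c := scaleFn ν a) left_mem_uIcc
  have hac2 := hac.add (g := fun _ => u a)
    (LipschitzOnWith.absolutelyContinuousOnInterval (K := 0) (by
      intro x _ y _; simp))
  -- The factor agrees with the integral only on the interval between the scale values, so absolute
  -- continuity is transferred through its ε–δ form, which sees only those points.
  refine (absolutelyContinuousOnInterval_iff _ _ _).2 fun e he => ?_
  obtain ⟨δ, hδ, H⟩ := (absolutelyContinuousOnInterval_iff _ _ _).1 hac2 e he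
  refine ⟨δ, hδ, fun E hE hEδ => ?_⟩
  have hval : ∀ t ∈ uIcc (scaleFn ν a) (scaleFn ν b),
      (u ∘ Function.invFun (scaleFn ν)) t =
      (∫ v in scaleFn ν a..t, h (Function.invFun (scaleFn ν) v)) + u a := by
    intro t ht
    rw [uIcc_of_le (hs.monotone hab)] at ht
    obtain ⟨x, hx, rfl⟩ := intermediate_value_Icc hab (continuous_scaleFn hν).continuousOn ht
    rw [← intervalIntegral_comp_scaleFn hν]
    simp only [hinv, Function.comp]
    rw [(hu a ha x (hI.out ha hb hx)).2]
    ring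
  refine lt_of_eq_of_lt ?_ (H E hE hEδ)
  refine Finset.sum_congr rfl fun i hi => ?_
  have := hE.1 i hi
  rw [hval _ this.1, hval _ this.2]
  rfl

/-- By Lebesgue differentiation any factor has derivative `h` almost everywhere in the scale
coordinate. Hence the factor chosen in `scaleDeriv` does not matter up to null sets. -/
theorem IsPrimitive.scaleDeriv_ae_eq (hν : IsAdmissible ν) {I : Set ℝ} (hI : I.OrdConnected)
    {u h : ℝ → ℝ} (hu : IsPrimitive ν I u h) :
    scaleDeriv ν I u =ᵐ[ν.restrict I] h := by
  have := hν.isNullSingletonClass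
  have hs := strictMono_scaleFn hν
  have hinv : ∀ x, Function.invFun (scaleFn ν) (scaleFn ν x) = x :=
    Function.leftInverse_invFun hs.injective
  have hA : AbsContWrt ν I u := ⟨_, hu.isScaleFactor hν hI⟩
  have hg := hA.choose_spec
  set g := hA.choose
  have hsd : ∀ x, scaleDeriv ν I u x = deriv g (scaleFn ν x) := by
    intro x; simp [scaleDeriv, hA, g]
  refine ae_restrict_of_forall_Ioc hI fun a ha b hb hab => ?_
  have hk : IntervalIntegrable (fun t => h (Function.invFun (scaleFn ν) t)) volume
      (scaleFn ν a) (scaleFn ν b) := by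
    rw [intervalIntegrable_comp_scaleFn_iff hν]
    simpa only [hinv] using (hu a ha b hb).1
  have hval : ∀ t ∈ Icc (scaleFn ν a) (scaleFn ν b), g t =
      (∫ v in scaleFn ν a..t, h (Function.invFun (scaleFn ν) v)) + u a := by
    intro t ht
    obtain ⟨x, hx, rfl⟩ := intermediate_value_Icc hab (continuous_scaleFn hν).continuousOn ht
    rw [← intervalIntegral_comp_scaleFn hν, ← hg.2 x (hI.out ha hb hx)]
    simp only [hinv]
    rw [(hu a ha x (hI.out ha hb hx)).2]
    ring
  have h1 : ∀ᵐ t ∂volume.restrict (Ioc (scaleFn ν a) (scaleFn ν b)),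
      deriv g t = h (Function.invFun (scaleFn ν) t) := by
    -- Only interior points are used: `deriv` needs the formula for `g` on a two-sided
    -- neighbourhood.
    rw [← restrict_Ioo_eq_restrict_Ioc, ae_restrict_iff' measurableSet_Ioo]
    filter_upwards [hk.ae_hasDerivAt_integral] with t ht htI
    rw [uIcc_of_le (hs.monotone hab)] at ht
    have h2 := (ht (Ioo_subset_Icc_self htI) (scaleFn ν a)
      (left_mem_Icc.2 (hs.monotone hab))).add_const (u a)
    refine (h2.congr_of_eventuallyEq ?_).deriv
    filter_upwards [isOpen_Ioo.mem_nhds htI] with r hr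
    exact hval r (Ioo_subset_Icc_self hr)
  rw [← map_scaleFn_restrict_Ioc hν hab] at h1
  have h2 := ae_of_ae_map (continuous_scaleFn hν).aemeasurable h1
  filter_upwards [h2] with x hx
  rw [hsd, hx, hinv]

end Scale

/-! ### Functions of finite energy as primitives of square integrable densities -/

section Representation

variable {m ν : Measure ℝ}

/-- The function with value `c` at `0` and `ν`-density `H`. -/
noncomputable def primitiveFn (ν : Measure ℝ) (c : ℝ) (H : ℝ → ℝ) (x : ℝ) : ℝ :=
  c + ∫ t in (0)..x, H t ∂ν

theorem primitiveFn_zero (c : ℝ) (H : ℝ → ℝ) : primitiveFn ν c H 0 = c := by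
  simp [primitiveFn]

theorem intervalIntegrable_of_memLp [IsLocallyFiniteMeasure ν] {H : ℝ → ℝ} (hH : MemLp H 2 ν)
    (a b : ℝ) : IntervalIntegrable H ν a b :=
  ⟨(hH.locallyIntegrable (by norm_num)).integrableOn_isCompact isCompact_Icc |>.mono_set
      Ioc_subset_Icc_self,
    (hH.locallyIntegrable (by norm_num)).integrableOn_isCompact isCompact_Icc |>.mono_set
      Ioc_subset_Icc_self⟩

theorem primitiveFn_sub [IsLocallyFiniteMeasure ν] {H : ℝ → ℝ} (hH : MemLp H 2 ν) (c a b : ℝ) :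
    primitiveFn ν c H b - primitiveFn ν c H a = ∫ t in a..b, H t ∂ν := by
  rw [primitiveFn, primitiveFn, add_sub_add_left_eq_sub,
    intervalIntegral.integral_interval_sub_left (intervalIntegrable_of_memLp hH _ _)
      (intervalIntegrable_of_memLp hH _ _)]

theorem isPrimitive_primitiveFn [IsLocallyFiniteMeasure ν] {H : ℝ → ℝ} (hH : MemLp H 2 ν) (c : ℝ)
    (I : Set ℝ) : IsPrimitive ν I (primitiveFn ν c H) H := fun a _ b _ =>
  ⟨intervalIntegrable_of_memLp hH a b, (primitiveFn_sub hH c a b).symm⟩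

theorem continuous_primitiveFn (hν : IsAdmissible ν) {H : ℝ → ℝ} (hH : MemLp H 2 ν) (c : ℝ) :
    Continuous (primitiveFn ν c H) := by
  have := hν.locallyFinite
  exact continuousOn_univ.1
    ((isPrimitive_primitiveFn hH c univ).continuousOn hν ordConnected_univ)

/-- The derivative is extended by zero outside `I`, so that the density lies in L² of the whole line
whatever `I` is. -/
theorem exists_primitiveFn_of_mem_diffusionDomain (hν : IsAdmissible ν) {I : Set ℝ}
    (hI : I.OrdConnected) (h0 : (0 : ℝ) ∈ I) {f : Lp ℝ 2 m} (hf : f ∈ diffusionDomain m ν I) :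
    ∃ (c : ℝ) (H : ℝ → ℝ), Measurable H ∧ MemLp H 2 ν ∧
      f =ᵐ[m.restrict I] primitiveFn ν c H ∧
      (Ici 0 ⊆ I → ν (Ici 0) < ⊤ → Tendsto (primitiveFn ν c H) atTop (𝓝 0)) ∧
      (Iic 0 ⊆ I → ν (Iic 0) < ⊤ → Tendsto (primitiveFn ν c H) atBot (𝓝 0)) := by
  obtain ⟨u, ⟨hu, hfu⟩, hint, htop, hbot⟩ := hf
  have hp := hu.isPrimitive hν
  have hmeas := measurable_scaleDeriv hν I u
  have hEq : ∀ x ∈ I, primitiveFn ν (u 0) (I.indicator (scaleDeriv ν I u)) x = u x := by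
    intro x hx
    have h1 : ∫ t in (0)..x, I.indicator (scaleDeriv ν I u) t ∂ν =
        ∫ t in (0)..x, scaleDeriv ν I u t ∂ν := by
      refine intervalIntegral.integral_congr fun t ht => ?_
      exact indicator_of_mem (hI.uIcc_subset h0 hx ht) _
    rw [primitiveFn, h1, (hp 0 h0 x hx).2]
    ring
  refine ⟨u 0, I.indicator (scaleDeriv ν I u), hmeas.indicator hI.measurableSet, ?_, ?_, ?_, ?_⟩
  · rw [memLp_indicator_iff_restrict hI.measurableSet,
      memLp_two_iff_integrable_sq hmeas.aestronglyMeasurable]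
    exact hint
  · filter_upwards [hfu, ae_restrict_mem hI.measurableSet] with x hx hxI
    rw [hx, hEq x hxI]
  · intro h1 h2
    refine (htop h1 h2).congr' ?_
    filter_upwards [Ici_mem_atTop 0] with x hx
    exact (hEq x (h1 hx)).symm
  · intro h1 h2
    refine (hbot h1 h2).congr' ?_
    filter_upwards [Iic_mem_atBot 0] with x hx
    exact (hEq x (h1 hx)).symm

theorem isVersion_primitiveFn (hν : IsAdmissible ν) {I : Set ℝ} (hI : I.OrdConnected)
    {f : Lp ℝ 2 m} {c : ℝ} {H : ℝ → ℝ} (hH : MemLp H 2 ν)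
    (hf : f =ᵐ[m.restrict I] primitiveFn ν c H) : IsVersion m ν I f (primitiveFn ν c H) := by
  have := hν.locallyFinite
  exact ⟨⟨_, (isPrimitive_primitiveFn hH c I).isScaleFactor hν hI⟩, hf⟩

theorem mem_diffusionDomain_of_primitiveFn (hν : IsAdmissible ν) {I : Set ℝ}
    (hI : I.OrdConnected) {f : Lp ℝ 2 m} {c : ℝ} {H : ℝ → ℝ} (hH : MemLp H 2 ν)
    (hf : f =ᵐ[m.restrict I] primitiveFn ν c H)
    (htop : Ici 0 ⊆ I → ν (Ici 0) < ⊤ → Tendsto (primitiveFn ν c H) atTop (𝓝 0))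
    (hbot : Iic 0 ⊆ I → ν (Iic 0) < ⊤ → Tendsto (primitiveFn ν c H) atBot (𝓝 0)) :
    f ∈ diffusionDomain m ν I := by
  have := hν.locallyFinite
  refine ⟨primitiveFn ν c H, isVersion_primitiveFn hν hI hH hf, ?_, htop, hbot⟩
  refine Integrable.congr (hH.restrict I).integrable_sq ?_
  filter_upwards [(isPrimitive_primitiveFn hH c I).scaleDeriv_ae_eq hν hI] with x hx
  rw [hx]

/-- Since `m` has full support, continuous functions that agree almost everywhere on `I` agree on
all of `I`. This makes the chosen version, in particular its value at 0, computable. -/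
theorem version_eqOn_primitiveFn (hm : IsAdmissible m) (hν : IsAdmissible ν) {I : Set ℝ}
    (hI : I.OrdConnected) (hI' : I ⊆ closure (interior I)) {f : Lp ℝ 2 m} {c : ℝ} {H : ℝ → ℝ}
    (hH : MemLp H 2 ν) (hf : f =ᵐ[m.restrict I] primitiveFn ν c H) :
    EqOn (version m ν I f) (primitiveFn ν c H) I ∧
      IsPrimitive ν I (version m ν I f) H := by
  have := hν.locallyFinite
  have := hm.fullSupport
  have hex : ∃ u, IsVersion m ν I f u := ⟨_, isVersion_primitiveFn hν hI hH hf⟩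
  have hv : IsVersion m ν I f (version m ν I f) := by
    rw [version, dif_pos hex]; exact hex.choose_spec
  have hE : EqOn (version m ν I f) (primitiveFn ν c H) I :=
    Measure.eqOn_of_ae_eq (μ := m) (hv.2.symm.trans hf)
      ((hv.1.isPrimitive hν).continuousOn hν hI) (continuous_primitiveFn hν hH c).continuousOn hI'
  refine ⟨hE, fun a ha b hb => ?_⟩
  rw [hE ha, hE hb]
  exact isPrimitive_primitiveFn hH c I a ha b hb

theorem diffusionEnergy_of_primitiveFn (hm : IsAdmissible m) (hν : IsAdmissible ν) {I : Set ℝ}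
    (hI : I.OrdConnected) (hI' : I ⊆ closure (interior I)) {f : Lp ℝ 2 m} {c : ℝ} {H : ℝ → ℝ}
    (hH : MemLp H 2 ν) (hf : f =ᵐ[m.restrict I] primitiveFn ν c H) :
    diffusionEnergy m ν I f f = 1 / 2 * ∫ x in I, H x ^ 2 ∂ν := by
  rw [diffusionEnergy]
  congr 1
  refine integral_congr_ae ?_
  filter_upwards [(version_eqOn_primitiveFn hm hν hI hI' hH hf).2.scaleDeriv_ae_eq hν hI]
    with x hx
  rw [hx, sq]

/-- `f` is represented by a pair of functions on the two half-lines with values `cp`, `cm` at `0`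
and with the common square integrable `ν`-density `H`, subject to the boundary conditions at
infinity. -/
structure SplitRep (m ν : Measure ℝ) (f : Lp ℝ 2 m) (cp cm : ℝ) (H : ℝ → ℝ) : Prop where
  measurable : Measurable H
  memLp : MemLp H 2 ν
  ae_pos : f =ᵐ[m.restrict (Ici 0)] primitiveFn ν cp H
  ae_neg : f =ᵐ[m.restrict (Iic 0)] primitiveFn ν cm H
  top : ν (Ici 0) < ⊤ → Tendsto (primitiveFn ν cp H) atTop (𝓝 0)
  bot : ν (Iic 0) < ⊤ → Tendsto (primitiveFn ν cm H) atBot (𝓝 0)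

theorem SplitRep.ae_eq {f : Lp ℝ 2 m} {c : ℝ} {H : ℝ → ℝ} (h : SplitRep m ν f c c H) :
    f =ᵐ[m] primitiveFn ν c H := by
  have : f =ᵐ[m.restrict (Iic 0 ∪ Ici 0)] primitiveFn ν c H :=
    ae_restrict_union_iff _ _ _ |>.2 ⟨h.ae_neg, h.ae_pos⟩
  rwa [Iic_union_Ici, Measure.restrict_univ] at this

theorem exists_splitRep_of_mem_irreducibleForm (hν : IsAdmissible ν) {f : Lp ℝ 2 m}
    (hf : f ∈ (irreducibleForm m ν).domain) : ∃ c H, SplitRep m ν f c c H := by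
  obtain ⟨c, H, hH, hL, hfe, htop, hbot⟩ :=
    exists_primitiveFn_of_mem_diffusionDomain hν ordConnected_univ (mem_univ _) hf
  rw [Measure.restrict_univ] at hfe
  exact ⟨c, H, hH, hL, ae_restrict_of_ae hfe, ae_restrict_of_ae hfe, htop (subset_univ _),
    hbot (subset_univ _)⟩

theorem SplitRep.energy_irreducibleForm (hm : IsAdmissible m) (hν : IsAdmissible ν)
    {f : Lp ℝ 2 m} {c : ℝ} {H : ℝ → ℝ} (h : SplitRep m ν f c c H) :
    (irreducibleForm m ν).energy f = ENNReal.ofReal (1 / 2 * ∫ x, H x ^ 2 ∂ν) := by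
  have hfe : f =ᵐ[m.restrict univ] primitiveFn ν c H := by
    rw [Measure.restrict_univ]; exact h.ae_eq
  have hmem : f ∈ (irreducibleForm m ν).domain :=
    mem_diffusionDomain_of_primitiveFn hν ordConnected_univ h.memLp hfe (fun _ => h.top)
      (fun _ => h.bot)
  rw [SymForm.energy, if_pos hmem]
  have := diffusionEnergy_of_primitiveFn hm hν ordConnected_univ (by simp) h.memLp hfe
  rw [Measure.restrict_univ] at this
  exact congrArg _ this

/-- The densities on the two half-lines are glued at 0; each primitive started at 0 sees only the
density on its own side. -/
theorem exists_splitRep_of_mem_reflectingForm (hν : IsAdmissible ν) {f : Lp ℝ 2 m}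
    (hf : f ∈ (reflectingForm m ν).domain) : ∃ cp cm H, SplitRep m ν f cp cm H := by
  have := hν.locallyFinite
  have := hν.isNullSingletonClass
  obtain ⟨cp, Hp, hp, hLp, hfp, htop, -⟩ :=
    exists_primitiveFn_of_mem_diffusionDomain hν ordConnected_Ici self_mem_Ici hf.1
  obtain ⟨cm, Hm, hm, hLm, hfm, -, hbot⟩ :=
    exists_primitiveFn_of_mem_diffusionDomain hν ordConnected_Iic self_mem_Iic hf.2
  classical
  set H := (Ioi (0 : ℝ)).piecewise Hp Hm
  have hP : ∀ x, 0 ≤ x → primitiveFn ν cp H x = primitiveFn ν cp Hp x := by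
    intro x hx
    unfold primitiveFn
    congr 1
    rw [intervalIntegral.integral_of_le hx, intervalIntegral.integral_of_le hx]
    exact setIntegral_congr_fun measurableSet_Ioc fun t ht => piecewise_eq_of_mem _ _ _ ht.1
  have hM : ∀ x, x ≤ 0 → primitiveFn ν cm H x = primitiveFn ν cm Hm x := by
    intro x hx
    unfold primitiveFn
    congr 1
    rw [intervalIntegral.integral_of_ge hx, intervalIntegral.integral_of_ge hx]
    congr 1
    exact setIntegral_congr_fun measurableSet_Ioc fun t ht =>
      piecewise_eq_of_notMem _ _ _ (not_lt.2 ht.2)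
  refine ⟨cp, cm, H, hp.piecewise measurableSet_Ioi hm, ?_, ?_, ?_, ?_, ?_⟩
  · exact MemLp.piecewise measurableSet_Ioi (hLp.restrict _) (hLm.restrict _)
  · filter_upwards [hfp, ae_restrict_mem measurableSet_Ici] with x hx hx0
    rw [hx, hP x hx0]
  · filter_upwards [hfm, ae_restrict_mem measurableSet_Iic] with x hx hx0
    rw [hx, hM x hx0]
  · intro h
    refine (htop subset_rfl h).congr' ?_
    filter_upwards [Ici_mem_atTop 0] with x hx
    exact (hP x hx).symm
  · intro h
    refine (hbot subset_rfl h).congr' ?_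
    filter_upwards [Iic_mem_atBot 0] with x hx
    exact (hM x hx).symm

theorem Ici_subset_closure_interior : Ici (0 : ℝ) ⊆ closure (interior (Ici 0)) := by simp

theorem Iic_subset_closure_interior : Iic (0 : ℝ) ⊆ closure (interior (Iic 0)) := by simp

theorem SplitRep.mem_reflectingForm (hν : IsAdmissible ν)
    {f : Lp ℝ 2 m} {cp cm : ℝ} {H : ℝ → ℝ} (h : SplitRep m ν f cp cm H) :
    f ∈ (reflectingForm m ν).domain := by
  have h0 : ¬ (Iic (0 : ℝ) ⊆ Ici 0) := fun hs => by
    have : (-1 : ℝ) ∈ Ici (0 : ℝ) := hs (by simp)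
    norm_num at this
  have h1 : ¬ (Ici (0 : ℝ) ⊆ Iic 0) := fun hs => by
    have : (1 : ℝ) ∈ Iic (0 : ℝ) := hs (by simp)
    norm_num at this
  exact ⟨mem_diffusionDomain_of_primitiveFn hν ordConnected_Ici h.memLp h.ae_pos
      (fun _ => h.top) (fun hs => (h0 hs).elim),
    mem_diffusionDomain_of_primitiveFn hν ordConnected_Iic h.memLp h.ae_neg
      (fun hs => (h1 hs).elim) (fun _ => h.bot)⟩

theorem SplitRep.reflectingForm_self (hm : IsAdmissible m) (hν : IsAdmissible ν)
    {f : Lp ℝ 2 m} {cp cm : ℝ} {H : ℝ → ℝ} (h : SplitRep m ν f cp cm H) :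
    (reflectingForm m ν).form f f = 1 / 2 * ∫ x, H x ^ 2 ∂ν := by
  have := hν.isNullSingletonClass
  change diffusionEnergy m ν (Ici 0) f f + diffusionEnergy m ν (Iic 0) f f = _
  rw [diffusionEnergy_of_primitiveFn hm hν ordConnected_Ici Ici_subset_closure_interior h.memLp
      h.ae_pos, diffusionEnergy_of_primitiveFn hm hν ordConnected_Iic Iic_subset_closure_interior
      h.memLp h.ae_neg, ← mul_add, integral_Ici_eq_integral_Ioi, ← compl_Iic, add_comm,
    integral_add_compl measurableSet_Iic h.memLp.integrable_sq]

theorem SplitRep.energy_reflectingForm (hm : IsAdmissible m) (hν : IsAdmissible ν)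
    {f : Lp ℝ 2 m} {cp cm : ℝ} {H : ℝ → ℝ} (h : SplitRep m ν f cp cm H) :
    (reflectingForm m ν).energy f = ENNReal.ofReal (1 / 2 * ∫ x, H x ^ 2 ∂ν) := by
  rw [SymForm.energy, if_pos (h.mem_reflectingForm hν), h.reflectingForm_self hm hν]

theorem SplitRep.jump_eq (hm : IsAdmissible m) (hν : IsAdmissible ν)
    {f : Lp ℝ 2 m} {cp cm : ℝ} {H : ℝ → ℝ} (h : SplitRep m ν f cp cm H) :
    jump m ν f = cp - cm := by
  rw [jump, (version_eqOn_primitiveFn hm hν ordConnected_Ici Ici_subset_closure_interior h.memLp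
      h.ae_pos).1 self_mem_Ici, (version_eqOn_primitiveFn hm hν ordConnected_Iic
      Iic_subset_closure_interior h.memLp h.ae_neg).1 self_mem_Iic, primitiveFn_zero,
      primitiveFn_zero]

theorem SplitRep.energy_snappingOutForm (hm : IsAdmissible m) (hν : IsAdmissible ν)
    {f : Lp ℝ 2 m} {cp cm : ℝ} {H : ℝ → ℝ} (h : SplitRep m ν f cp cm H) {κ : ℝ} (hκ : 0 ≤ κ) :
    (snappingOutForm m ν κ hκ).energy f =
      ENNReal.ofReal (1 / 2 * ∫ x, H x ^ 2 ∂ν + κ / 4 * (cp - cm) ^ 2) := by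
  have hmem : f ∈ (snappingOutForm m ν κ hκ).domain := h.mem_reflectingForm hν
  rw [SymForm.energy, if_pos hmem]
  change ENNReal.ofReal ((reflectingForm m ν).form f f + κ / 4 * (jump m ν f * jump m ν f)) = _
  rw [h.reflectingForm_self hm hν, h.jump_eq hm hν, sq (cp - cm)]

end Representation

/-! ### The resistance with barrier, pulled back by the spreading map -/

section Barrier

variable {ν γ : Measure ℝ} {ε : ℝ}

theorem measurable_spread (ε : ℝ) : Measurable (spread ε) :=
  Measurable.ite measurableSet_Ici (measurable_id.add_const ε) (measurable_id.sub_const ε)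

theorem spread_of_nonneg {x : ℝ} (hx : 0 ≤ x) : spread ε x = x + ε := if_pos hx

theorem spread_of_neg {x : ℝ} (hx : x < 0) : spread ε x = x - ε := if_neg (not_le.2 hx)

theorem spread_preimage_Ioc_nonneg (hε : 0 < ε) {a b : ℝ} (ha : 0 ≤ a) :
    spread ε ⁻¹' Ioc (a + ε) (b + ε) = Ioc a b := by
  ext x
  rcases le_or_gt 0 x with hx | hx
  · simp [spread_of_nonneg hx]
  · simp only [mem_preimage, spread_of_neg hx, mem_Ioc]
    constructor <;> rintro ⟨h1, h2⟩ <;> linarith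

/-- Because `spread` sends 0 to the right, to `ε`, the point 0 drops out of preimages on the left.
It is a null set for admissible measures. -/
theorem spread_preimage_Ioc_nonpos (hε : 0 < ε) {a b : ℝ} (hb : b ≤ 0) :
    spread ε ⁻¹' Ioc (a - ε) (b - ε) = Ioc a b \ {0} := by
  ext x
  rcases le_or_gt 0 x with hx | hx
  · simp only [mem_preimage, spread_of_nonneg hx, mem_Ioc, Set.mem_sdiff, mem_singleton_iff]
    constructor
    · rintro ⟨h1, h2⟩; linarith
    · rintro ⟨⟨h1, h2⟩, h3⟩; exact (h3 (by linarith)).elim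
  · simp [spread_of_neg hx, hx.ne]

theorem spread_preimage_Ioc_barrier (hε : 0 < ε) :
    spread ε ⁻¹' Ioc (-ε) ε = {0} := by
  ext x
  rcases le_or_gt 0 x with hx | hx
  · simp only [mem_preimage, spread_of_nonneg hx, mem_Ioc, mem_singleton_iff]
    constructor
    · rintro ⟨h1, h2⟩; linarith
    · rintro rfl; constructor <;> linarith
  · simp only [mem_preimage, spread_of_neg hx, mem_Ioc, mem_singleton_iff, hx.ne, iff_false]
    rintro ⟨h1, h2⟩; linarith

theorem IsBarrier.measure_eq_zero (hγ : IsBarrier ε γ) {S : Set ℝ}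
    (hS : ∀ x ∈ S, x ≤ -ε ∨ ε ≤ x) : γ S = 0 := by
  refine measure_mono_null (t := (Ioo (-ε) ε)ᶜ) (fun x hx h => ?_) hγ.null_compl
  rcases hS x hx with h1 | h1
  · exact absurd h.1 (not_lt.2 h1)
  · exact absurd h.2 (not_lt.2 h1)

theorem restrict_barrierResistance {S : Set ℝ} (hS : MeasurableSet S) :
    (barrierResistance ν ε γ).restrict S =
      (ν.restrict (spread ε ⁻¹' S)).map (spread ε) + γ.restrict S := by
  rw [barrierResistance, Measure.restrict_add, Measure.restrict_map (measurable_spread ε) hS]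

theorem intervalIntegral_barrierResistance_nonneg (hγ : IsBarrier ε γ) (hε : 0 < ε) {h : ℝ → ℝ}
    (hh : Measurable h) {a b : ℝ} (ha : 0 ≤ a) (hab : a ≤ b) :
    ∫ x in a + ε..b + ε, h x ∂(barrierResistance ν ε γ) = ∫ x in a..b, h (spread ε x) ∂ν := by
  have h0 : γ.restrict (Ioc (a + ε) (b + ε)) = 0 := by
    rw [Measure.restrict_eq_zero]
    exact hγ.measure_eq_zero fun x hx => Or.inr (by linarith [hx.1])
  rw [intervalIntegral.integral_of_le (by linarith), intervalIntegral.integral_of_le hab,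
    restrict_barrierResistance measurableSet_Ioc, h0, add_zero,
    integral_map (measurable_spread ε).aemeasurable hh.aestronglyMeasurable,
    spread_preimage_Ioc_nonneg hε ha]

theorem intervalIntegral_barrierResistance_nonpos (hν : IsAdmissible ν) (hγ : IsBarrier ε γ)
    (hε : 0 < ε) {h : ℝ → ℝ} (hh : Measurable h) {a b : ℝ} (hb : b ≤ 0) (hab : a ≤ b) :
    ∫ x in a - ε..b - ε, h x ∂(barrierResistance ν ε γ) = ∫ x in a..b, h (spread ε x) ∂ν := by
  have h0 : γ.restrict (Ioc (a - ε) (b - ε)) = 0 := by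
    rw [Measure.restrict_eq_zero]
    exact hγ.measure_eq_zero fun x hx => Or.inl (by linarith [hx.2])
  rw [intervalIntegral.integral_of_le (by linarith), intervalIntegral.integral_of_le hab,
    restrict_barrierResistance measurableSet_Ioc, h0, add_zero,
    integral_map (measurable_spread ε).aemeasurable hh.aestronglyMeasurable,
    spread_preimage_Ioc_nonpos hε hb,
    Measure.restrict_congr_set (sdiff_null_ae_eq_self (hν.noAtoms 0))]

theorem restrict_barrierResistance_Ioc (hν : IsAdmissible ν) (hγ : IsBarrier ε γ) (hε : 0 < ε) :
    (barrierResistance ν ε γ).restrict (Ioc (-ε) ε) = γ := by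
  rw [restrict_barrierResistance measurableSet_Ioc, spread_preimage_Ioc_barrier hε,
    Measure.restrict_eq_zero.2 (hν.noAtoms 0), Measure.map_zero, zero_add]
  refine Measure.restrict_eq_self_of_ae_mem ?_
  rw [ae_iff]
  refine hγ.measure_eq_zero fun x hx => ?_
  by_contra! h
  exact hx ⟨h.1, h.2.le⟩

theorem intervalIntegral_barrierResistance_barrier (hν : IsAdmissible ν) (hγ : IsBarrier ε γ)
    (hε : 0 < ε) (h : ℝ → ℝ) :
    ∫ x in -ε..ε, h x ∂(barrierResistance ν ε γ) = ∫ x, h x ∂γ := by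
  rw [intervalIntegral.integral_of_le (by linarith), restrict_barrierResistance_Ioc hν hγ hε]

theorem spread_preimage_Ioo_subset {x r : ℝ} :
    spread ε ⁻¹' Ioo (x - r) (x + r) ⊆
      Ioo (x - ε - r) (x - ε + r) ∪ Ioo (x + ε - r) (x + ε + r) := by
  intro y hy
  rcases le_or_gt 0 y with h | h
  · rw [mem_preimage, spread_of_nonneg h] at hy
    exact Or.inl ⟨by linarith [hy.1], by linarith [hy.2]⟩
  · rw [mem_preimage, spread_of_neg h] at hy
    exact Or.inr ⟨by linarith [hy.1], by linarith [hy.2]⟩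

theorem IsAdmissible.barrierResistance (hν : IsAdmissible ν) (hγ : IsBarrier ε γ) :
    IsAdmissible (barrierResistance ν ε γ) := by
  have := hν.locallyFinite
  have := hν.fullSupport
  have := hγ.finite
  refine ⟨⟨fun x => ⟨Ioo (x - 1) (x + 1), Ioo_mem_nhds (by linarith) (by linarith), ?_⟩⟩,
    ⟨fun U hU hne => ?_⟩, fun x => ?_⟩
  · rw [StiffProblem.barrierResistance, Measure.add_apply,
      Measure.map_apply (measurable_spread ε) measurableSet_Ioo]
    refine ENNReal.add_lt_top.2 ⟨?_, measure_lt_top _ _⟩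
    refine (measure_mono spread_preimage_Ioo_subset).trans_lt ?_
    exact measure_union_lt_top measure_Ioo_lt_top measure_Ioo_lt_top
  · rw [StiffProblem.barrierResistance, Measure.add_apply,
      Measure.map_apply (measurable_spread ε) hU.measurableSet, ne_eq, add_eq_zero]
    rintro ⟨h1, h2⟩
    by_cases hI : (U ∩ Ioo (-ε) ε).Nonempty
    · have := hγ.fullSupport _ (hU.inter isOpen_Ioo) inter_subset_right hI
      exact this.ne' (measure_mono_null inter_subset_left h2)
    by_cases hP : (U ∩ Ioi ε).Nonempty
    · have hO : IsOpen ((fun y => y + ε) ⁻¹' (U ∩ Ioi ε)) :=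
        (hU.inter isOpen_Ioi).preimage (by fun_prop)
      obtain ⟨z, hz⟩ := hP
      refine (hO.measure_pos ν ⟨z - ε, by simpa using hz⟩).ne'
        (measure_mono_null ?_ h1)
      intro y hy
      have : 0 ≤ y := by have := hy.2; simp only [mem_Ioi] at this; linarith
      rw [mem_preimage, spread_of_nonneg this]
      exact hy.1
    by_cases hN : (U ∩ Iio (-ε)).Nonempty
    · have hO : IsOpen ((fun y => y - ε) ⁻¹' (U ∩ Iio (-ε))) :=
        (hU.inter isOpen_Iio).preimage (by fun_prop)
      obtain ⟨z, hz⟩ := hN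
      refine (hO.measure_pos ν ⟨z + ε, by simpa only [mem_preimage, add_sub_cancel_right] using hz⟩).ne'
        (measure_mono_null ?_ h1)
      intro y hy
      have : y < 0 := by have := hy.2; simp only [mem_Iio] at this; linarith
      rw [mem_preimage, spread_of_neg this]
      exact hy.1
    -- An open set missing the barrier and both outer half-lines lies in two points; Lebesgue
    -- measure excludes this for a nonempty open set.
    have hsub : U ⊆ {-ε, ε} := by
      intro y hy
      by_contra hn
      simp only [mem_insert_iff, mem_singleton_iff, not_or] at hn
      rcases lt_trichotomy y (-ε) with h | h | h
      · exact hN ⟨y, hy, h⟩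
      · exact hn.1 h
      rcases lt_trichotomy y ε with h' | h' | h'
      · exact hI ⟨y, hy, h, h'⟩
      · exact hn.2 h'
      · exact hP ⟨y, hy, h'⟩
    exact ((hU.measure_pos volume hne).trans_le (measure_mono hsub)).ne'
      ((Set.toFinite {-ε, ε}).measure_zero volume)
  · rw [StiffProblem.barrierResistance, Measure.add_apply, hγ.noAtoms, add_zero,
      Measure.map_apply (measurable_spread ε) (measurableSet_singleton x)]
    have hsub : spread ε ⁻¹' {x} ⊆ {x - ε} ∪ {x + ε} := by
      intro y hy
      rcases le_or_gt 0 y with h | h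
      · rw [mem_preimage, spread_of_nonneg h, mem_singleton_iff] at hy
        exact Or.inl (by rw [mem_singleton_iff]; linarith)
      · rw [mem_preimage, spread_of_neg h, mem_singleton_iff] at hy
        exact Or.inr (by rw [mem_singleton_iff]; linarith)
    exact measure_mono_null hsub (measure_union_null (hν.noAtoms _) (hν.noAtoms _))

theorem memLp_barrierResistance_iff {h : ℝ → ℝ} (hh : Measurable h) :
    MemLp h 2 (barrierResistance ν ε γ) ↔ MemLp (fun x => h (spread ε x)) 2 ν ∧ MemLp h 2 γ := by
  rw [memLp_two_iff_integrable_sq hh.aestronglyMeasurable,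
    memLp_two_iff_integrable_sq hh.aestronglyMeasurable,
    memLp_two_iff_integrable_sq (f := fun x => h (spread ε x))
      (hh.comp (measurable_spread ε)).aestronglyMeasurable,
    barrierResistance, integrable_add_measure, integrable_map_measure
      (hh.pow_const 2).aestronglyMeasurable (measurable_spread ε).aemeasurable]
  rfl

theorem integral_sq_barrierResistance {h : ℝ → ℝ} (hh : Measurable h)
    (hL : MemLp h 2 (barrierResistance ν ε γ)) :
    ∫ x, h x ^ 2 ∂(barrierResistance ν ε γ) =
      ∫ x, h (spread ε x) ^ 2 ∂ν + ∫ x, h x ^ 2 ∂γ := by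
  have hi := hL.integrable_sq
  rw [barrierResistance] at hi ⊢
  rw [integral_add_measure hi.left_of_add_measure hi.right_of_add_measure,
    integral_map (measurable_spread ε).aemeasurable (hh.pow_const 2).aestronglyMeasurable]

/-- The barrier is finite, so the boundary condition at infinity is imposed with the barrier exactly
when it is imposed without it. -/
theorem barrierResistance_Ici_lt_top_iff (hγ : IsBarrier ε γ) (hε : 0 < ε) :
    barrierResistance ν ε γ (Ici 0) < ⊤ ↔ ν (Ici 0) < ⊤ := by
  have := hγ.finite
  have : spread ε ⁻¹' Ici 0 = Ici 0 := by
    ext x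
    rcases le_or_gt 0 x with h | h
    · simp only [mem_preimage, spread_of_nonneg h, mem_Ici, h, iff_true]; linarith
    · simp only [mem_preimage, spread_of_neg h, mem_Ici, not_le.2 h, iff_false]; linarith
  rw [barrierResistance, Measure.add_apply, Measure.map_apply (measurable_spread ε)
    measurableSet_Ici, this, ENNReal.add_lt_top]
  simp

theorem barrierResistance_Iic_lt_top_iff (hν : IsAdmissible ν) (hγ : IsBarrier ε γ) (hε : 0 < ε) :
    barrierResistance ν ε γ (Iic 0) < ⊤ ↔ ν (Iic 0) < ⊤ := by
  have := hγ.finite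
  have := hν.isNullSingletonClass
  have : spread ε ⁻¹' Iic 0 = Iio 0 := by
    ext x
    rcases le_or_gt 0 x with h | h
    · simp only [mem_preimage, spread_of_nonneg h, mem_Iic, mem_Iio, not_lt.2 h, iff_false]
      linarith
    · simp only [mem_preimage, spread_of_neg h, mem_Iic, mem_Iio, h, iff_true]; linarith
  rw [barrierResistance, Measure.add_apply, Measure.map_apply (measurable_spread ε)
    measurableSet_Iic, this, ENNReal.add_lt_top, measure_congr Iio_ae_eq_Iic]
  simp

/-- Beyond the barrier the new resistance is a translate of `ν`, so the primitive restarts from its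
value at `ε` with the pulled-back density. -/
theorem primitiveFn_barrierResistance_nonneg (hν : IsAdmissible ν) (hγ : IsBarrier ε γ)
    (hε : 0 < ε) {h : ℝ → ℝ} (hh : Measurable h) (hL : MemLp h 2 (barrierResistance ν ε γ))
    (c : ℝ) {x : ℝ} (hx : ε ≤ x) :
    primitiveFn (barrierResistance ν ε γ) c h x =
      primitiveFn ν (primitiveFn (barrierResistance ν ε γ) c h ε) (fun y => h (spread ε y))
        (x - ε) := by
  have := (hν.barrierResistance hγ).locallyFinite
  have h1 := intervalIntegral_barrierResistance_nonneg (ν := ν) hγ hε hh le_rfl (sub_nonneg.2 hx)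
  rw [zero_add, sub_add_cancel, ← primitiveFn_sub hL c] at h1
  conv_rhs => rw [primitiveFn, ← h1]
  ring

theorem primitiveFn_barrierResistance_nonpos (hν : IsAdmissible ν) (hγ : IsBarrier ε γ)
    (hε : 0 < ε) {h : ℝ → ℝ} (hh : Measurable h) (hL : MemLp h 2 (barrierResistance ν ε γ))
    (c : ℝ) {x : ℝ} (hx : x ≤ -ε) :
    primitiveFn (barrierResistance ν ε γ) c h x =
      primitiveFn ν (primitiveFn (barrierResistance ν ε γ) c h (-ε)) (fun y => h (spread ε y))
        (x + ε) := by
  have := (hν.barrierResistance hγ).locallyFinite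
  have h1 := intervalIntegral_barrierResistance_nonpos hν hγ hε hh le_rfl
    (show x + ε ≤ 0 by linarith)
  rw [zero_sub, add_sub_cancel_right, ← primitiveFn_sub hL c] at h1
  conv_rhs => rw [primitiveFn, intervalIntegral.integral_symm, ← h1]
  ring

theorem primitiveFn_barrierResistance_jump (hν : IsAdmissible ν) (hγ : IsBarrier ε γ)
    (hε : 0 < ε) {h : ℝ → ℝ} (hL : MemLp h 2 (barrierResistance ν ε γ)) (c : ℝ) :
    primitiveFn (barrierResistance ν ε γ) c h ε - primitiveFn (barrierResistance ν ε γ) c h (-ε) =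
      ∫ x, h x ∂γ := by
  have := (hν.barrierResistance hγ).locallyFinite
  rw [primitiveFn_sub hL, intervalIntegral_barrierResistance_barrier hν hγ hε]

end Barrier

/-! ### Cauchy–Schwarz and weak convergence -/

section Weak

variable {m ν : Measure ℝ}

theorem sq_integral_le_measure_mul_integral_sq {μ : Measure ℝ} [IsFiniteMeasure μ] {f : ℝ → ℝ}
    (hf : MemLp f 2 μ) : (∫ x, f x ∂μ) ^ 2 ≤ μ.real univ * ∫ x, f x ^ 2 ∂μ := by
  have h1 : Integrable f μ := hf.integrable (by norm_num)
  have h2 := hf.integrable_sq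
  have key : ∀ c : ℝ, 0 ≤ ∫ x, f x ^ 2 ∂μ - 2 * c * ∫ x, f x ∂μ + c ^ 2 * μ.real univ := by
    intro c
    have : ∫ x, (f x - c) ^ 2 ∂μ =
        ∫ x, f x ^ 2 ∂μ - 2 * c * ∫ x, f x ∂μ + c ^ 2 * μ.real univ := by
      have he : ∀ x, (f x - c) ^ 2 = f x ^ 2 - 2 * c * f x + c ^ 2 := fun x => by ring
      simp only [he]
      rw [integral_add (f := fun x => f x ^ 2 - 2 * c * f x) (h2.sub (h1.const_mul _))
        (integrable_const _), integral_sub h2 (h1.const_mul _), integral_const_mul,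
        integral_const, smul_eq_mul]
      ring
    rw [← this]
    exact integral_nonneg fun _ => sq_nonneg _
  rcases (measureReal_nonneg (μ := μ) (s := univ)).eq_or_lt with h0 | h0
  · have : μ = 0 := by
      rw [← Measure.measure_univ_eq_zero]
      exact (measureReal_eq_zero_iff (measure_ne_top _ _)).1 h0.symm
    simp [this]
  · have h3 := key ((∫ x, f x ∂μ) / μ.real univ)
    have h4 : ∫ x, f x ^ 2 ∂μ - 2 * ((∫ x, f x ∂μ) / μ.real univ) * ∫ x, f x ∂μ +
        ((∫ x, f x ∂μ) / μ.real univ) ^ 2 * μ.real univ =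
        ∫ x, f x ^ 2 ∂μ - (∫ x, f x ∂μ) ^ 2 / μ.real univ := by
      field_simp
      ring
    rw [h4, sub_nonneg, div_le_iff₀ h0] at h3
    linarith

theorem sq_intervalIntegral_le (hν : IsAdmissible ν) {f : ℝ → ℝ} (hf : MemLp f 2 ν) (a b : ℝ) :
    (∫ x in a..b, f x ∂ν) ^ 2 ≤ |scaleFn ν b - scaleFn ν a| * ∫ x, f x ^ 2 ∂ν := by
  wlog hab : a ≤ b generalizing a b
  · rw [intervalIntegral.integral_symm, neg_sq, abs_sub_comm]
    exact this b a (le_of_not_ge hab)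
  have := hν.locallyFinite
  have : IsFiniteMeasure (ν.restrict (Ioc a b)) := ⟨by
    rw [Measure.restrict_apply_univ]; exact measure_Ioc_lt_top⟩
  rw [intervalIntegral.integral_of_le hab]
  refine (sq_integral_le_measure_mul_integral_sq (hf.restrict _)).trans ?_
  have h1 : (ν.restrict (Ioc a b)).real univ = |scaleFn ν b - scaleFn ν a| := by
    rw [abs_of_nonneg (sub_nonneg.2 ((strictMono_scaleFn hν).monotone hab)), scaleFn_sub hν hab]
    simp [Measure.real]
  rw [h1]
  refine mul_le_mul_of_nonneg_left ?_ (abs_nonneg _)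
  exact setIntegral_le_integral hf.integrable_sq (ae_of_all _ fun _ => sq_nonneg _)

/-- Sequential Banach–Alaoglu in the dual of a separable space, carried back by the Riesz
isomorphism. -/
theorem exists_weak_subseq_limit {E : Type*} [NormedAddCommGroup E] [InnerProductSpace ℝ E]
    [CompleteSpace E] [TopologicalSpace.SeparableSpace E] {u : ℕ → E} {R : ℝ}
    (hu : ∀ n, ‖u n‖ ≤ R) :
    ∃ (x : E) (φ : ℕ → ℕ), StrictMono φ ∧
      ∀ w : E, Tendsto (fun n => inner ℝ (u (φ n)) w) atTop (𝓝 (inner ℝ x w)) := by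
  have hc := WeakDual.isSeqCompact_closedBall ℝ E 0 R
  obtain ⟨a, -, φ, hφ, ha⟩ := hc
    (x := fun n => StrongDual.toWeakDual (InnerProductSpace.toDual ℝ E (u n))) (fun n => by
      simpa using hu n)
  refine ⟨(InnerProductSpace.toDual ℝ E).symm (WeakDual.toStrongDual a), φ, hφ, fun w => ?_⟩
  have h := ((WeakDual.eval_continuous (𝕜 := ℝ) w).tendsto a).comp ha
  rw [InnerProductSpace.toDual_symm_apply]
  exact h

theorem tendsto_setIntegral_of_weak {f : ℕ → Lp ℝ 2 m} {v : Lp ℝ 2 m}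
    (hf : ∀ w, Tendsto (fun n => inner ℝ (f n) w) atTop (𝓝 (inner ℝ v w))) {A : Set ℝ}
    (hA : MeasurableSet A) (hmA : m A ≠ ⊤) :
    Tendsto (fun n => ∫ x in A, f n x ∂m) atTop (𝓝 (∫ x in A, v x ∂m)) := by
  have h : ∀ g : Lp ℝ 2 m, inner ℝ g (indicatorConstLp 2 hA hmA 1) = ∫ x in A, g x ∂m := by
    intro g
    rw [real_inner_comm, L2.inner_indicatorConstLp_one]
  simpa only [h] using hf (indicatorConstLp 2 hA hmA 1)

/-- For a fixed endpoint this is testing against an indicator. The endpoint may move because bounded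
L² norms make the primitives uniformly ½-Hölder in the scale coordinate. -/
theorem tendsto_intervalIntegral_of_weak (hν : IsAdmissible ν) {H : ℕ → Lp ℝ 2 ν}
    {H₀ : Lp ℝ 2 ν} (hH : ∀ w, Tendsto (fun n => inner ℝ (H n) w) atTop (𝓝 (inner ℝ H₀ w)))
    {C : ℝ} (hC : ∀ n, ∫ x, H n x ^ 2 ∂ν ≤ C) {x : ℕ → ℝ} {x₀ : ℝ}
    (hx : Tendsto x atTop (𝓝 x₀)) (a : ℝ) :
    Tendsto (fun n => ∫ t in a..x n, H n t ∂ν) atTop (𝓝 (∫ t in a..x₀, H₀ t ∂ν)) := by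
  have := hν.locallyFinite
  have h1 : Tendsto (fun n => ∫ t in a..x₀, H n t ∂ν) atTop (𝓝 (∫ t in a..x₀, H₀ t ∂ν)) := by
    simp only [intervalIntegral]
    exact (tendsto_setIntegral_of_weak hH measurableSet_Ioc measure_Ioc_lt_top.ne).sub
      (tendsto_setIntegral_of_weak hH measurableSet_Ioc measure_Ioc_lt_top.ne)
  have h2 : Tendsto (fun n => ∫ t in x₀..x n, H n t ∂ν) atTop (𝓝 0) := by
    have h3 : Tendsto (fun n => √(|scaleFn ν (x n) - scaleFn ν x₀| * C)) atTop (𝓝 0) := by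
      have hc : Continuous fun y => √(|scaleFn ν y - scaleFn ν x₀| * C) := by
        have := continuous_scaleFn hν
        fun_prop
      have := (hc.tendsto x₀).comp hx
      simp only [sub_self, abs_zero, zero_mul, Real.sqrt_zero] at this
      exact this
    refine squeeze_zero_norm (fun n => ?_) h3
    refine Real.abs_le_sqrt ?_
    exact (sq_intervalIntegral_le hν (Lp.memLp (H n)) _ _).trans
      (mul_le_mul_of_nonneg_left (hC n) (abs_nonneg _))
  have h4 := h1.add h2
  rw [add_zero] at h4
  refine h4.congr fun n => ?_
  exact intervalIntegral.integral_add_adjacent_intervals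
    (intervalIntegrable_of_memLp (Lp.memLp (H n)) _ _)
    (intervalIntegrable_of_memLp (Lp.memLp (H n)) _ _)

/-- Integrating `f n - d n` over a bounded set `A` has a limit by dominated convergence, and
integrating `f n` has one by weak convergence; so `m(A) * d n` converges. One set of positive mass
gives the limit of `d n`, and varying `A` then identifies `v`. -/
theorem exists_tendsto_const_of_weak (hm : IsAdmissible m) {f : ℕ → Lp ℝ 2 m} {v : Lp ℝ 2 m}
    (hf : ∀ w, Tendsto (fun n => inner ℝ (f n) w) atTop (𝓝 (inner ℝ v w))) {S : Set ℝ}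
    (hS : IsOpen S) (hS' : S.OrdConnected) (hne : S.Nonempty) {w : ℕ → ℝ → ℝ} {d : ℕ → ℝ}
    {P : ℝ → ℝ} (hP : Continuous P) (hfw : ∀ n, f n =ᵐ[m.restrict S] w n)
    (hpt : ∀ x ∈ S, Tendsto (fun n => w n x - d n) atTop (𝓝 (P x)))
    (hbd : ∀ a ∈ S, ∀ b ∈ S, ∃ B, ∀ᶠ n in atTop, ∀ x ∈ Icc a b, |w n x - d n| ≤ B) :
    ∃ c, Tendsto d atTop (𝓝 c) ∧ v =ᵐ[m.restrict S] fun x => c + P x := by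
  have := hm.locallyFinite
  have := hm.fullSupport
  have := hm.isNullSingletonClass
  have key : ∀ a ∈ S, ∀ b ∈ S, ∀ A ⊆ Icc a b, MeasurableSet A →
      Tendsto (fun n => m.real A * d n) atTop (𝓝 (∫ x in A, v x ∂m - ∫ x in A, P x ∂m)) := by
    intro a ha b hb A hA hAm
    have hAS : A ⊆ S := hA.trans (hS'.out ha hb)
    have hmA : m A < ⊤ := (measure_mono hA).trans_lt measure_Icc_lt_top
    have : IsFiniteMeasure (m.restrict A) := ⟨by rwa [Measure.restrict_apply_univ]⟩
    obtain ⟨B, hB⟩ := hbd a ha b hb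
    have hfw' : ∀ n, ∀ᵐ x ∂m.restrict A, f n x = w n x := fun n =>
      ae_restrict_of_ae_restrict_of_subset hAS (hfw n)
    have hif : ∀ g : Lp ℝ 2 m, Integrable g (m.restrict A) := fun g =>
      ((Lp.memLp g).restrict A).integrable (by norm_num)
    have h1 : Tendsto (fun n => ∫ x in A, (f n x - d n) ∂m) atTop (𝓝 (∫ x in A, P x ∂m)) := by
      refine tendsto_integral_filter_of_dominated_convergence (fun _ => B) ?_ ?_
        (integrable_const _) ?_
      · exact Eventually.of_forall fun n =>
          ((hif (f n)).sub (integrable_const _)).aestronglyMeasurable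
      · filter_upwards [hB] with n hn
        filter_upwards [hfw' n, ae_restrict_mem hAm] with x hx hxA
        rw [hx]
        exact hn x (hA hxA)
      · filter_upwards [ae_all_iff.2 hfw', ae_restrict_mem hAm] with x hx hxA
        simp only [hx]
        exact hpt x (hAS hxA)
    refine ((tendsto_setIntegral_of_weak hf hAm hmA.ne).sub h1).congr fun n => ?_
    rw [integral_sub (hif _) (integrable_const _), integral_const, smul_eq_mul]
    simp
  obtain ⟨x₀, hx₀⟩ := hne
  obtain ⟨r, hr, hrS⟩ := Metric.isOpen_iff.1 hS x₀ hx₀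
  rw [Real.ball_eq_Ioo] at hrS
  have ha : x₀ - r / 2 ∈ S := hrS ⟨by linarith, by linarith⟩
  have hb : x₀ + r / 2 ∈ S := hrS ⟨by linarith, by linarith⟩
  have hmpos : 0 < m.real (Icc (x₀ - r / 2) (x₀ + r / 2)) := by
    refine ENNReal.toReal_pos ?_ measure_Icc_lt_top.ne
    exact ((isOpen_Ioo.measure_pos m (nonempty_Ioo.2 (by linarith))).trans_le
      (measure_mono Ioo_subset_Icc_self)).ne'
  have h1 := (key _ ha _ hb _ subset_rfl measurableSet_Icc).const_mul
    (m.real (Icc (x₀ - r / 2) (x₀ + r / 2)))⁻¹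
  simp only [inv_mul_cancel_left₀ hmpos.ne'] at h1
  refine ⟨_, h1, ?_⟩
  set c := (m.real (Icc (x₀ - r / 2) (x₀ + r / 2)))⁻¹ *
    (∫ x in Icc (x₀ - r / 2) (x₀ + r / 2), v x ∂m - ∫ x in Icc (x₀ - r / 2) (x₀ + r / 2), P x ∂m)
  refine ae_restrict_of_forall_Ioc hS' fun a ha b hb hab => ?_
  have hfin : IsFiniteMeasure (m.restrict (Ioc a b)) := ⟨by
    rw [Measure.restrict_apply_univ]; exact measure_Ioc_lt_top⟩
  have hiP : Integrable P (m.restrict (Ioc a b)) :=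
    (hP.integrableOn_Icc (a := a) (b := b)).mono_set Ioc_subset_Icc_self
  have hiv : Integrable v (m.restrict (Ioc a b)) :=
    ((Lp.memLp v).restrict _).integrable (by norm_num)
  have hi : Integrable (fun x => v x - P x - c) (m.restrict (Ioc a b)) :=
    (hiv.sub hiP).sub (integrable_const _)
  have h0 := hi.ae_eq_zero_of_forall_setIntegral_eq_zero (fun A hA _ => by
    rw [Measure.restrict_restrict hA]
    have hsub : A ∩ Ioc a b ⊆ Icc a b := inter_subset_right.trans Ioc_subset_Icc_self
    have h2 := key a ha b hb (A ∩ Ioc a b) hsub (hA.inter measurableSet_Ioc)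
    -- Two limits of `m(A) * d n`: one from `key`, the other from the limit `c` of `d n`.
    have h3 := tendsto_nhds_unique h2 (h1.const_mul _)
    have hle : m.restrict (A ∩ Ioc a b) ≤ m.restrict (Ioc a b) :=
      Measure.restrict_mono inter_subset_right le_rfl
    have : IsFiniteMeasure (m.restrict (A ∩ Ioc a b)) := isFiniteMeasure_of_le _ hle
    rw [integral_sub (f := fun x => v x - P x)
      ((hiv.mono_measure hle).sub (hiP.mono_measure hle)) (integrable_const _),
      integral_sub (hiv.mono_measure hle) (hiP.mono_measure hle), h3, integral_const,
      smul_eq_mul]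
    simp)
  filter_upwards [h0] with x hx
  simp only [Pi.zero_apply] at hx
  linarith

end Weak

/-! ### Lower bound: limits of sequences with bounded energy -/

section LowerBound

variable {m ν : Measure ℝ}

theorem integral_sq_eq_norm_sq (g : Lp ℝ 2 ν) : ∫ x, g x ^ 2 ∂ν = ‖g‖ ^ 2 := by
  rw [← real_inner_self_eq_norm_sq, L2.inner_def]
  simp [sq]

theorem primitiveFn_congr_ae {c : ℝ} {H K : ℝ → ℝ} (h : H =ᵐ[ν] K) (x : ℝ) :
    primitiveFn ν c H x = primitiveFn ν c K x := by
  unfold primitiveFn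
  congr 1
  exact intervalIntegral.integral_congr_ae (h.mono fun _ hx _ => hx)

theorem integrableOn_of_memLp_two {H : ℝ → ℝ} (hH : MemLp H 2 ν) {S : Set ℝ} (hS : ν S < ⊤) :
    IntegrableOn H S ν := by
  have : IsFiniteMeasure (ν.restrict S) := ⟨by rwa [Measure.restrict_apply_univ]⟩
  exact (hH.restrict S).integrable (by norm_num)

theorem tendsto_primitiveFn_atTop {H : ℝ → ℝ} (hH : MemLp H 2 ν) (hfin : ν (Ici 0) < ⊤) (c r : ℝ) :
    Tendsto (fun x => primitiveFn ν c H (x + r)) atTop (𝓝 (c + ∫ t in Ioi 0, H t ∂ν)) :=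
  (intervalIntegral_tendsto_integral_Ioi 0 (integrableOn_of_memLp_two hH
    ((measure_mono Ioi_subset_Ici_self).trans_lt hfin))
    (tendsto_atTop_add_const_right _ r tendsto_id)).const_add c

theorem tendsto_primitiveFn_atBot {H : ℝ → ℝ} (hH : MemLp H 2 ν) (hfin : ν (Iic 0) < ⊤) (c r : ℝ) :
    Tendsto (fun x => primitiveFn ν c H (x + r)) atBot (𝓝 (c - ∫ t in Iic 0, H t ∂ν)) := by
  have h := (intervalIntegral_tendsto_integral_Iic 0 (integrableOn_of_memLp_two hH hfin)
    (tendsto_atBot_add_const_right _ r tendsto_id)).const_sub c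
  refine h.congr fun x => ?_
  rw [primitiveFn, intervalIntegral.integral_symm 0, sub_neg_eq_add]
  rfl

/-- The final inequality carries the jump term: Cauchy–Schwarz on the barrier bounds the squared
jump by the barrier mass times the part of `C` left over by the bulk density. -/
theorem exists_splitRep_of_weak (hm : IsAdmissible m) (hν : IsAdmissible ν) {ε : ℕ → ℝ}
    (hε : ∀ n, 0 < ε n) (hε0 : Tendsto ε atTop (𝓝 0)) {γ : ℕ → Measure ℝ}
    (hγ : ∀ n, IsBarrier (ε n) (γ n)) {f : ℕ → Lp ℝ 2 m} {v : Lp ℝ 2 m}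
    (hf : ∀ w, Tendsto (fun n => inner ℝ (f n) w) atTop (𝓝 (inner ℝ v w)))
    {c : ℕ → ℝ} {h : ℕ → ℝ → ℝ}
    (hrep : ∀ n, SplitRep m (barrierResistance ν (ε n) (γ n)) (f n) (c n) (c n) (h n)) {C : ℝ}
    (hC : ∀ n, ∫ x, h n x ^ 2 ∂(barrierResistance ν (ε n) (γ n)) ≤ C) {H : ℕ → Lp ℝ 2 ν}
    (hHn : ∀ n, H n =ᵐ[ν] fun x => h n (spread (ε n) x)) {H₀ : Lp ℝ 2 ν}
    (hH : ∀ w, Tendsto (fun n => inner ℝ (H n) w) atTop (𝓝 (inner ℝ H₀ w))) :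
    ∃ cp cm, SplitRep m ν v cp cm H₀ ∧ ∫ x, H₀ x ^ 2 ∂ν ≤ C ∧
      ∀ g, Tendsto (fun n => (γ n).real univ) atTop (𝓝 g) →
        (cp - cm) ^ 2 ≤ g * (C - ∫ x, H₀ x ^ 2 ∂ν) := by
  have := hν.locallyFinite
  have hsum : ∀ n, ∫ x, H n x ^ 2 ∂ν + ∫ x, h n x ^ 2 ∂(γ n) ≤ C := by
    intro n
    refine le_trans (le_of_eq ?_) (hC n)
    rw [integral_sq_barrierResistance (hrep n).measurable (hrep n).memLp]
    congr 1
    exact integral_congr_ae ((hHn n).mono fun x hx => by simp only [hx])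
  have hHC : ∀ n, ∫ x, H n x ^ 2 ∂ν ≤ C := fun n =>
    le_trans (le_add_of_nonneg_right (integral_nonneg fun _ => sq_nonneg _)) (hsum n)
  have hC0 : 0 ≤ C := (integral_nonneg fun _ => sq_nonneg _).trans (hHC 0)
  have hs := strictMono_scaleFn hν
  set w : ℕ → ℝ → ℝ := fun n => primitiveFn (barrierResistance ν (ε n) (γ n)) (c n) (h n) with hw
  have hpos : ∀ n x, ε n ≤ x → w n x = primitiveFn ν (w n (ε n)) (H n) (x - ε n) := by
    intro n x hx
    rw [primitiveFn_congr_ae (hHn n)]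
    exact primitiveFn_barrierResistance_nonneg hν (hγ n) (hε n) (hrep n).measurable
      (hrep n).memLp (c n) hx
  have hneg : ∀ n x, x ≤ -ε n → w n x = primitiveFn ν (w n (-ε n)) (H n) (x + ε n) := by
    intro n x hx
    rw [primitiveFn_congr_ae (hHn n)]
    exact primitiveFn_barrierResistance_nonpos hν (hγ n) (hε n) (hrep n).measurable
      (hrep n).memLp (c n) hx
  have hPc : Continuous fun x => ∫ t in (0)..x, H₀ t ∂ν :=
    (continuous_primitiveFn hν (Lp.memLp H₀) 0).congr fun x => by simp [primitiveFn]
  have hev : ∀ r : ℝ, 0 < r → ∀ᶠ n in atTop, ε n < r := fun r hr => hε0.eventually_lt_const hr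
  obtain ⟨cp, hcp, hvp⟩ := exists_tendsto_const_of_weak hm hf (S := Ioi 0) isOpen_Ioi
    ordConnected_Ioi ⟨1, by simp⟩ (w := w) (d := fun n => w n (ε n)) hPc
    (fun n => ae_restrict_of_ae (hrep n).ae_eq)
    (by
      intro x hx
      have h1 : Tendsto (fun n => x - ε n) atTop (𝓝 x) := by simpa using hε0.const_sub x
      refine (tendsto_intervalIntegral_of_weak hν hH hHC h1 0).congr' ?_
      filter_upwards [hev x hx] with n hn
      rw [hpos n x hn.le, primitiveFn]
      ring)
    (by
      intro a ha b hb
      refine ⟨√(scaleFn ν b * C), ?_⟩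
      filter_upwards [hev a ha] with n hn x hx
      rw [hpos n x (hn.le.trans hx.1), primitiveFn, add_sub_cancel_left]
      refine Real.abs_le_sqrt ((sq_intervalIntegral_le hν (Lp.memLp _) _ _).trans ?_)
      have h0 : 0 ≤ x - ε n := by linarith [hx.1]
      have h1 : scaleFn ν 0 ≤ scaleFn ν (x - ε n) := hs.monotone h0
      have h2 : scaleFn ν (x - ε n) ≤ scaleFn ν b :=
        hs.monotone (by linarith [hx.2, hε n])
      rw [abs_of_nonneg (by linarith)]
      rw [scaleFn_zero hν] at h1 ⊢
      refine mul_le_mul (by linarith) (hHC n) (integral_nonneg fun _ => sq_nonneg _)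
        (h1.trans h2))
  obtain ⟨cm, hcm, hvm⟩ := exists_tendsto_const_of_weak hm hf (S := Iio 0) isOpen_Iio
    ordConnected_Iio ⟨-1, by simp⟩ (w := w) (d := fun n => w n (-ε n)) hPc
    (fun n => ae_restrict_of_ae (hrep n).ae_eq)
    (by
      intro x hx
      have h1 : Tendsto (fun n => x + ε n) atTop (𝓝 x) := by simpa using hε0.const_add x
      refine (tendsto_intervalIntegral_of_weak hν hH hHC h1 0).congr' ?_
      filter_upwards [hev (-x) (neg_pos.2 hx)] with n hn
      rw [hneg n x (by linarith), primitiveFn]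
      ring)
    (by
      intro a ha b hb
      refine ⟨√(-scaleFn ν a * C), ?_⟩
      filter_upwards [hev (-b) (neg_pos.2 hb)] with n hn x hx
      rw [hneg n x (by linarith [hx.2]), primitiveFn, add_sub_cancel_left]
      refine Real.abs_le_sqrt ((sq_intervalIntegral_le hν (Lp.memLp _) _ _).trans ?_)
      have h0 : x + ε n ≤ 0 := by linarith [hx.2]
      have h1 : scaleFn ν (x + ε n) ≤ scaleFn ν 0 := hs.monotone h0
      have h2 : scaleFn ν a ≤ scaleFn ν (x + ε n) :=
        hs.monotone (by linarith [hx.1, hε n])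
      rw [abs_of_nonpos (by linarith)]
      rw [scaleFn_zero hν] at h1 ⊢
      refine mul_le_mul (by linarith) (hHC n) (integral_nonneg fun _ => sq_nonneg _)
        (by linarith))
  have hm0 := hm.isNullSingletonClass
  have hinner := hH H₀
  rw [real_inner_self_eq_norm_sq] at hinner
  have hlow : Tendsto (fun n => 2 * inner ℝ (H n) H₀ - ‖H₀‖ ^ 2) atTop (𝓝 (‖H₀‖ ^ 2)) := by
    have := (hinner.const_mul 2).sub_const (‖H₀‖ ^ 2)
    convert this using 2
    ring
  -- Expanding ‖H_n − H₀‖² ≥ 0 gives a minorant of ‖H_n‖² affine in H_n. It converges to ‖H₀‖², so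
  -- it can be used inside products where a liminf would be awkward.
  have hlow_le : ∀ n, 2 * inner ℝ (H n) H₀ - ‖H₀‖ ^ 2 ≤ ∫ x, H n x ^ 2 ∂ν := by
    intro n
    rw [integral_sq_eq_norm_sq]
    have := norm_sub_sq_real (H n) H₀
    nlinarith [sq_nonneg ‖H n - H₀‖]
  refine ⟨cp, cm, ⟨(Lp.stronglyMeasurable H₀).measurable, Lp.memLp H₀, ?_, ?_, ?_, ?_⟩, ?_, ?_⟩
  · rw [← restrict_Ioi_eq_restrict_Ici]
    exact hvp
  · rw [← restrict_Iio_eq_restrict_Iic]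
    exact hvm
  · intro hfin
    -- Vanishing at infinity determines the value at `ε n` as minus an integral over the half-line.
    -- With finite length its indicator is in L², so the identity survives weak limits.
    have h1 : ∀ n, w n (ε n) = -∫ x in Ioi 0, H n x ∂ν := by
      intro n
      have h2 := (hrep n).top ((barrierResistance_Ici_lt_top_iff (hγ n) (hε n)).2 hfin)
      have h3 := tendsto_primitiveFn_atTop (Lp.memLp (H n)) hfin (w n (ε n)) (-ε n)
      have h4 := tendsto_nhds_unique (h2.congr' ?_) h3
      · linarith
      · filter_upwards [Ici_mem_atTop (ε n)] with x hx
        exact hpos n x hx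
    have h5 : Tendsto (fun n => w n (ε n)) atTop (𝓝 (-∫ x in Ioi 0, H₀ x ∂ν)) := by
      simp only [h1]
      exact (tendsto_setIntegral_of_weak hH measurableSet_Ioi
        ((measure_mono Ioi_subset_Ici_self).trans_lt hfin).ne).neg
    have h6 := tendsto_nhds_unique hcp h5
    have h7 := tendsto_primitiveFn_atTop (Lp.memLp H₀) hfin cp 0
    simpa [h6] using h7
  · intro hfin
    have h1 : ∀ n, w n (-ε n) = ∫ x in Iic 0, H n x ∂ν := by
      intro n
      have h2 := (hrep n).bot ((barrierResistance_Iic_lt_top_iff hν (hγ n) (hε n)).2 hfin)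
      have h3 := tendsto_primitiveFn_atBot (Lp.memLp (H n)) hfin (w n (-ε n)) (ε n)
      have h4 := tendsto_nhds_unique (h2.congr' ?_) h3
      · linarith
      · filter_upwards [Iic_mem_atBot (-ε n)] with x hx
        exact hneg n x hx
    have h5 : Tendsto (fun n => w n (-ε n)) atTop (𝓝 (∫ x in Iic 0, H₀ x ∂ν)) := by
      simp only [h1]
      exact tendsto_setIntegral_of_weak hH measurableSet_Iic hfin.ne
    have h6 := tendsto_nhds_unique hcm h5
    have h7 := tendsto_primitiveFn_atBot (Lp.memLp H₀) hfin cm 0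
    simpa [h6] using h7
  · rw [integral_sq_eq_norm_sq]
    exact le_of_tendsto hlow (Eventually.of_forall fun n => (hlow_le n).trans (hHC n))
  · intro g hg
    rw [integral_sq_eq_norm_sq]
    refine le_of_tendsto_of_tendsto' ((hcp.sub hcm).pow 2) (hg.mul (hlow.const_sub C)) fun n => ?_
    have := (hγ n).finite
    have h1 := ((memLp_barrierResistance_iff (hrep n).measurable).1 (hrep n).memLp).2
    rw [hw, primitiveFn_barrierResistance_jump hν (hγ n) (hε n) (hrep n).memLp]
    refine (sq_integral_le_measure_mul_integral_sq h1).trans ?_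
    refine mul_le_mul_of_nonneg_left ?_ measureReal_nonneg
    linarith [hsum n, hlow_le n]

/-- The bound obtained for the limit of a weakly convergent sequence with bounded energies. -/
theorem exists_splitRep_of_energy_le (hm : IsAdmissible m) (hν : IsAdmissible ν) {ε : ℕ → ℝ}
    (hε : ∀ n, 0 < ε n) (hε0 : Tendsto ε atTop (𝓝 0)) {γ : ℕ → Measure ℝ}
    (hγ : ∀ n, IsBarrier (ε n) (γ n)) {f : ℕ → Lp ℝ 2 m} {v : Lp ℝ 2 m}
    (hf : ∀ w, Tendsto (fun n => inner ℝ (f n) w) atTop (𝓝 (inner ℝ v w))) {C : ℝ}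
    (hfreq : ∃ᶠ n in atTop, (irreducibleForm m (barrierResistance ν (ε n) (γ n))).energy (f n) ≤
      ENNReal.ofReal C) (hC0 : 0 ≤ C) :
    ∃ cp cm H, SplitRep m ν v cp cm H ∧ ∫ x, H x ^ 2 ∂ν ≤ 2 * C ∧
      ∀ g, Tendsto (fun n => (γ n).real univ) atTop (𝓝 g) →
        (cp - cm) ^ 2 ≤ g * (2 * C - ∫ x, H x ^ 2 ∂ν) := by
  have := hν.locallyFinite
  -- The first subsequence keeps the energies below `C`, hence the functions in the domains; a
  -- second one makes the pulled-back densities converge weakly.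
  obtain ⟨φ, hφ, hφC⟩ := extraction_of_frequently_atTop hfreq
  have hadm : ∀ n, IsAdmissible (barrierResistance ν (ε n) (γ n)) := fun n =>
    hν.barrierResistance (hγ n)
  have hex : ∀ n, ∃ (c : ℝ) (h : ℝ → ℝ),
      SplitRep m (barrierResistance ν (ε (φ n)) (γ (φ n))) (f (φ n)) c c h := by
    intro n
    refine exists_splitRep_of_mem_irreducibleForm (hadm _) ?_
    by_contra hn
    have := hφC n
    rw [SymForm.energy, if_neg hn] at this
    exact absurd this (by simp)
  choose c h hrep using hex
  have hC : ∀ n, ∫ x, h n x ^ 2 ∂(barrierResistance ν (ε (φ n)) (γ (φ n))) ≤ 2 * C := by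
    intro n
    have h1 := hφC n
    rw [(hrep n).energy_irreducibleForm hm (hadm _), ENNReal.ofReal_le_ofReal_iff hC0] at h1
    linarith
  have hL : ∀ n, MemLp (fun x => h n (spread (ε (φ n)) x)) 2 ν := fun n =>
    ((memLp_barrierResistance_iff (hrep n).measurable).1 (hrep n).memLp).1
  have hbd : ∀ n, ‖(hL n).toLp‖ ≤ √(2 * C) := by
    intro n
    refine Real.le_sqrt_of_sq_le ?_
    rw [← integral_sq_eq_norm_sq]
    refine le_trans (le_trans (le_of_eq ?_) (le_add_of_nonneg_right
      (integral_nonneg (μ := γ (φ n)) (f := fun x => h n x ^ 2) fun _ => sq_nonneg _)))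
      ((integral_sq_barrierResistance (hrep n).measurable (hrep n).memLp).symm.trans_le (hC n))
    exact integral_congr_ae ((hL n).coeFn_toLp.mono fun x hx => by simp only [hx])
  have : Fact ((2 : ℝ≥0∞) ≠ ⊤) := ⟨by norm_num⟩
  obtain ⟨H₀, ψ, hψ, hweak⟩ := exists_weak_subseq_limit hbd
  have hlim : Tendsto (fun n => φ (ψ n)) atTop atTop :=
    hφ.tendsto_atTop.comp hψ.tendsto_atTop
  obtain ⟨cp, cm, hS, h1, h2⟩ := exists_splitRep_of_weak hm hν (fun n => hε (φ (ψ n)))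
    (hε0.comp hlim) (fun n => hγ (φ (ψ n))) (fun w => (hf w).comp hlim) (fun n => hrep (ψ n))
    (fun n => hC (ψ n)) (fun n => (hL (ψ n)).coeFn_toLp) hweak
  exact ⟨cp, cm, H₀, hS, h1, fun g hg => h2 g (hg.comp hlim)⟩

end LowerBound

/-! ### Recovery sequences: spreading a function across the barrier -/

section Recovery

variable {m ν γ : Measure ℝ} {ε : ℝ}

/-- Cauchy–Schwarz on each window of length `ε` yields the factor `supMass ν ε`. After exchanging
the integrals, each `t` is seen by `x` in a window of length `ε`, which yields `supMass m ε`. -/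
theorem lintegral_sq_increment_le (hm : IsAdmissible m) (hν : IsAdmissible ν) (hε : 0 < ε)
    {H : ℝ → ℝ} (hH : Measurable H) (hL : MemLp H 2 ν) (r : ℝ) :
    ∫⁻ x, ENNReal.ofReal ((∫ t in x + r..x + r + ε, H t ∂ν) ^ 2) ∂m ≤
      supMass ν ε * supMass m ε * ENNReal.ofReal (∫ t, H t ^ 2 ∂ν) := by
  have := hν.locallyFinite
  have := hm.locallyFinite
  set G : ℝ → ℝ≥0∞ := fun t => ENNReal.ofReal (H t ^ 2) with hG
  have hGm : Measurable G := (hH.pow_const 2).ennreal_ofReal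
  have h1 : ∀ x, ENNReal.ofReal ((∫ t in x + r..x + r + ε, H t ∂ν) ^ 2) ≤
      supMass ν ε * ∫⁻ t, (Ioc (x + r) (x + r + ε)).indicator G t ∂ν := by
    intro x
    have hle : x + r ≤ x + r + ε := by linarith
    have hfin : IsFiniteMeasure (ν.restrict (Ioc (x + r) (x + r + ε))) := ⟨by
      rw [Measure.restrict_apply_univ]; exact measure_Ioc_lt_top⟩
    rw [intervalIntegral.integral_of_le hle, lintegral_indicator measurableSet_Ioc]
    refine (ENNReal.ofReal_le_ofReal
      (sq_integral_le_measure_mul_integral_sq (hL.restrict _))).trans ?_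
    rw [ENNReal.ofReal_mul measureReal_nonneg, ofReal_measureReal, Measure.restrict_apply_univ,
      ofReal_integral_eq_lintegral_ofReal (hL.restrict _).integrable_sq
        (ae_of_all _ fun _ => sq_nonneg _)]
    gcongr
    exact (measure_mono Ioc_subset_Icc_self).trans (le_iSup (fun y => ν (Icc y (y + ε))) _)
  have hset : MeasurableSet {p : ℝ × ℝ | p.2 ∈ Ioc (p.1 + r) (p.1 + r + ε)} :=
    (measurableSet_lt (measurable_fst.add_const r) measurable_snd).inter
      (measurableSet_le measurable_snd ((measurable_fst.add_const r).add_const ε))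
  have hmeas : Measurable (Function.uncurry fun x t => (Ioc (x + r) (x + r + ε)).indicator G t) :=
    (hGm.comp measurable_snd).indicator hset
  calc ∫⁻ x, ENNReal.ofReal ((∫ t in x + r..x + r + ε, H t ∂ν) ^ 2) ∂m
      ≤ ∫⁻ x, supMass ν ε * ∫⁻ t, (Ioc (x + r) (x + r + ε)).indicator G t ∂ν ∂m :=
        lintegral_mono h1
    _ = supMass ν ε * ∫⁻ t, ∫⁻ x, (Ioc (x + r) (x + r + ε)).indicator G t ∂m ∂ν := by
        rw [← lintegral_lintegral_swap hmeas.aemeasurable]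
        exact lintegral_const_mul _ hmeas.lintegral_prod_right
    _ ≤ supMass ν ε * ∫⁻ t, supMass m ε * G t ∂ν := by
        gcongr with t
        have h2 : ∀ x, (Ioc (x + r) (x + r + ε)).indicator G t =
            (Ico (t - r - ε) (t - r)).indicator (fun _ => G t) x := by
          intro x
          simp only [indicator, mem_Ioc, mem_Ico]
          congr 1
          refine propext ⟨fun h => ⟨?_, ?_⟩, fun h => ⟨?_, ?_⟩⟩ <;> linarith [h.1, h.2]
        simp only [h2]
        rw [lintegral_indicator_const measurableSet_Ico, mul_comm]
        gcongr
        refine (measure_mono (t := Icc (t - r - ε) (t - r - ε + ε)) ?_).trans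
          (le_iSup (fun y => m (Icc y (y + ε))) _)
        rw [sub_add_cancel]
        exact Ico_subset_Icc_self
    _ = supMass ν ε * supMass m ε * ENNReal.ofReal (∫ t, H t ^ 2 ∂ν) := by
        rw [lintegral_const_mul _ hGm, mul_assoc, ofReal_integral_eq_lintegral_ofReal
          hL.integrable_sq (ae_of_all _ fun _ => sq_nonneg _)]

/-- The density obtained by moving `H` out of the barrier and filling the barrier with the constant
density of total increment `J`. -/
noncomputable def barrierDensity (H : ℝ → ℝ) (J ε : ℝ) (γ : Measure ℝ) (x : ℝ) : ℝ :=
  if ε ≤ x then H (x - ε) else if x ≤ -ε then H (x + ε) else J / γ.real univ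

theorem measurable_barrierDensity {H : ℝ → ℝ} (hH : Measurable H) (J ε : ℝ) (γ : Measure ℝ) :
    Measurable (barrierDensity H J ε γ) :=
  Measurable.ite measurableSet_Ici (hH.comp (measurable_id.sub_const ε))
    (Measurable.ite measurableSet_Iic (hH.comp (measurable_id.add_const ε)) measurable_const)

theorem barrierDensity_spread (hε : 0 < ε) (H : ℝ → ℝ) (J : ℝ) (γ : Measure ℝ) (x : ℝ) :
    barrierDensity H J ε γ (spread ε x) = H x := by
  rcases le_or_gt 0 x with hx | hx
  · rw [spread_of_nonneg hx, barrierDensity, if_pos (by linarith), add_sub_cancel_right]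
  · rw [spread_of_neg hx, barrierDensity, if_neg (by linarith), if_pos (by linarith),
      sub_add_cancel]

theorem barrierDensity_ae_eq (hγ : IsBarrier ε γ) (H : ℝ → ℝ) (J : ℝ) :
    barrierDensity H J ε γ =ᵐ[γ] fun _ => J / γ.real univ := by
  have h : ∀ᵐ x ∂γ, x ∈ Ioo (-ε) ε := hγ.null_compl
  filter_upwards [h] with x hx
  rw [barrierDensity, if_neg (not_le.2 hx.2), if_neg (not_le.2 hx.1)]

theorem IsBarrier.real_univ_pos (hγ : IsBarrier ε γ) (hε : 0 < ε) : 0 < γ.real univ := by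
  have := hγ.finite
  refine ENNReal.toReal_pos ?_ (measure_ne_top _ _)
  exact ((hγ.fullSupport _ isOpen_Ioo subset_rfl (nonempty_Ioo.2 (by linarith))).trans_le
    (measure_mono (subset_univ _))).ne'

theorem memLp_barrierDensity (hγ : IsBarrier ε γ) (hε : 0 < ε) {H : ℝ → ℝ} (hH : Measurable H)
    (hL : MemLp H 2 ν) (J : ℝ) :
    MemLp (barrierDensity H J ε γ) 2 (barrierResistance ν ε γ) := by
  have := hγ.finite
  rw [memLp_barrierResistance_iff (measurable_barrierDensity hH J ε γ)]
  simp only [barrierDensity_spread hε]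
  exact ⟨hL, (memLp_congr_ae (barrierDensity_ae_eq hγ H J)).2 (memLp_const _)⟩

theorem integral_sq_barrierDensity (hγ : IsBarrier ε γ) (hε : 0 < ε) {H : ℝ → ℝ}
    (hH : Measurable H) (hL : MemLp H 2 ν) (J : ℝ) :
    ∫ x, barrierDensity H J ε γ x ^ 2 ∂(barrierResistance ν ε γ) =
      ∫ x, H x ^ 2 ∂ν + J ^ 2 / γ.real univ := by
  have h0 := (hγ.real_univ_pos hε).ne'
  rw [integral_sq_barrierResistance (measurable_barrierDensity hH J ε γ)
    (memLp_barrierDensity hγ hε hH hL J)]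
  simp only [barrierDensity_spread hε]
  congr 1
  rw [integral_congr_ae ((barrierDensity_ae_eq hγ H J).mono fun x hx => by simp only [hx] :
    (fun x => barrierDensity H J ε γ x ^ 2) =ᵐ[γ] fun _ => (J / γ.real univ) ^ 2), integral_const,
    smul_eq_mul]
  field_simp

theorem integral_barrierDensity (hγ : IsBarrier ε γ) (hε : 0 < ε) (H : ℝ → ℝ) (J : ℝ) :
    ∫ x, barrierDensity H J ε γ x ∂γ = J ∧ ∫ x, ‖barrierDensity H J ε γ x‖ ∂γ = |J| := by
  have h0 := hγ.real_univ_pos hε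
  constructor
  · rw [integral_congr_ae (barrierDensity_ae_eq hγ H J), integral_const, smul_eq_mul]
    field_simp
  · rw [integral_congr_ae ((barrierDensity_ae_eq hγ H J).mono fun x hx => by simp only [hx] :
      (fun x => ‖barrierDensity H J ε γ x‖) =ᵐ[γ] fun _ => ‖J / γ.real univ‖), integral_const,
      smul_eq_mul, Real.norm_eq_abs, abs_div, abs_of_pos h0]
    field_simp

/-- The value at `0` for which the primitive of `barrierDensity` equals `cm` at `-ε`. -/
noncomputable def barrierValue (ν : Measure ℝ) (H : ℝ → ℝ) (cp cm ε : ℝ) (γ : Measure ℝ) : ℝ :=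
  cm - ∫ t in (0)..-ε, barrierDensity H (cp - cm) ε γ t ∂(barrierResistance ν ε γ)

/-- The function on `ℝ` which is the spread of the pair of primitives of `H` with values `cp`, `cm`
at `0`, interpolated along the barrier. -/
noncomputable def barrierFn (ν : Measure ℝ) (H : ℝ → ℝ) (cp cm ε : ℝ) (γ : Measure ℝ) : ℝ → ℝ :=
  primitiveFn (barrierResistance ν ε γ) (barrierValue ν H cp cm ε γ)
    (barrierDensity H (cp - cm) ε γ)

theorem barrierFn_neg_self (H : ℝ → ℝ) (cp cm : ℝ) : barrierFn ν H cp cm ε γ (-ε) = cm := by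
  rw [barrierFn, primitiveFn, barrierValue, sub_add_cancel]

theorem barrierFn_self (hν : IsAdmissible ν) (hγ : IsBarrier ε γ) (hε : 0 < ε) {H : ℝ → ℝ}
    (hH : Measurable H) (hL : MemLp H 2 ν) (cp cm : ℝ) : barrierFn ν H cp cm ε γ ε = cp := by
  have h := primitiveFn_barrierResistance_jump hν hγ hε
    (memLp_barrierDensity hγ hε hH hL (cp - cm)) (barrierValue ν H cp cm ε γ)
  rw [(integral_barrierDensity hγ hε H (cp - cm)).1] at h
  have h2 := barrierFn_neg_self (ν := ν) (γ := γ) (ε := ε) H cp cm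
  rw [barrierFn] at h2 ⊢
  linarith

theorem barrierFn_of_le (hν : IsAdmissible ν) (hγ : IsBarrier ε γ) (hε : 0 < ε) {H : ℝ → ℝ}
    (hH : Measurable H) (hL : MemLp H 2 ν) (cp cm : ℝ) {x : ℝ} (hx : ε ≤ x) :
    barrierFn ν H cp cm ε γ x = primitiveFn ν cp H (x - ε) := by
  have h := primitiveFn_barrierResistance_nonneg hν hγ hε (measurable_barrierDensity hH _ ε γ)
    (memLp_barrierDensity hγ hε hH hL (cp - cm)) (barrierValue ν H cp cm ε γ) hx
  simp only [barrierDensity_spread hε] at h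
  rw [barrierFn, h]
  congr 1
  exact barrierFn_self hν hγ hε hH hL cp cm

theorem barrierFn_of_le_neg (hν : IsAdmissible ν) (hγ : IsBarrier ε γ) (hε : 0 < ε) {H : ℝ → ℝ}
    (hH : Measurable H) (hL : MemLp H 2 ν) (cp cm : ℝ) {x : ℝ} (hx : x ≤ -ε) :
    barrierFn ν H cp cm ε γ x = primitiveFn ν cm H (x + ε) := by
  have h := primitiveFn_barrierResistance_nonpos hν hγ hε (measurable_barrierDensity hH _ ε γ)
    (memLp_barrierDensity hγ hε hH hL (cp - cm)) (barrierValue ν H cp cm ε γ) hx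
  simp only [barrierDensity_spread hε] at h
  rw [barrierFn, h]
  congr 1
  exact barrierFn_neg_self H cp cm

/-- The density has constant sign on the barrier, so its integral of absolute value there is exactly
|cp − cm|. -/
theorem abs_barrierFn_sub_le (hν : IsAdmissible ν) (hγ : IsBarrier ε γ) (hε : 0 < ε) {H : ℝ → ℝ}
    (hH : Measurable H) (hL : MemLp H 2 ν) (cp cm : ℝ) {x : ℝ} (hx : x ∈ Icc (-ε) ε) :
    |barrierFn ν H cp cm ε γ x - cm| ≤ |cp - cm| := by
  have hadm := hν.barrierResistance hγ
  have := hadm.locallyFinite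
  have hL' := memLp_barrierDensity hγ hε hH hL (cp - cm)
  have h1 : barrierFn ν H cp cm ε γ x - cm =
      ∫ t in (-ε)..x, barrierDensity H (cp - cm) ε γ t ∂(barrierResistance ν ε γ) := by
    rw [← primitiveFn_sub hL' (barrierValue ν H cp cm ε γ)]
    exact congrArg _ (barrierFn_neg_self H cp cm).symm
  rw [h1, intervalIntegral.integral_of_le hx.1, ← (integral_barrierDensity hγ hε H (cp - cm)).2,
    ← Real.norm_eq_abs]
  refine (norm_integral_le_integral_norm _).trans ?_
  have h2 : ∫ t, ‖barrierDensity H (cp - cm) ε γ t‖ ∂γ =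
      ∫ t in Ioc (-ε) ε, ‖barrierDensity H (cp - cm) ε γ t‖ ∂(barrierResistance ν ε γ) := by
    rw [restrict_barrierResistance_Ioc hν hγ hε]
  rw [h2]
  refine setIntegral_mono_set ?_ (ae_of_all _ fun _ => norm_nonneg _)
    (Ioc_subset_Ioc_right hx.2).eventuallyLE
  exact (intervalIntegrable_of_memLp hL' (-ε) ε).1.norm

theorem splitRep_barrierFn (hν : IsAdmissible ν) (hγ : IsBarrier ε γ) (hε : 0 < ε)
    {v f : Lp ℝ 2 m} {cp cm : ℝ} {H : ℝ → ℝ} (hv : SplitRep m ν v cp cm H)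
    (hf : f =ᵐ[m] barrierFn ν H cp cm ε γ) :
    SplitRep m (barrierResistance ν ε γ) f (barrierValue ν H cp cm ε γ)
      (barrierValue ν H cp cm ε γ) (barrierDensity H (cp - cm) ε γ) where
  measurable := measurable_barrierDensity hv.measurable _ ε γ
  memLp := memLp_barrierDensity hγ hε hv.measurable hv.memLp _
  ae_pos := ae_restrict_of_ae hf
  ae_neg := ae_restrict_of_ae hf
  top h := by
    have h1 := hv.top ((barrierResistance_Ici_lt_top_iff hγ hε).1 h)
    refine (h1.comp (tendsto_atTop_add_const_right _ (-ε) tendsto_id)).congr' ?_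
    filter_upwards [Ici_mem_atTop ε] with x hx
    exact (barrierFn_of_le hν hγ hε hv.measurable hv.memLp cp cm hx).symm
  bot h := by
    have h1 := hv.bot ((barrierResistance_Iic_lt_top_iff hν hγ hε).1 h)
    refine (h1.comp (tendsto_atBot_add_const_right _ ε tendsto_id)).congr' ?_
    filter_upwards [Iic_mem_atBot (-ε)] with x hx
    exact (barrierFn_of_le_neg hν hγ hε hv.measurable hv.memLp cp cm hx).symm

theorem lintegral_sq_barrierFn_sub_le (hm : IsAdmissible m) (hν : IsAdmissible ν)
    (hγ : IsBarrier ε γ) (hε : 0 < ε) {v : Lp ℝ 2 m} {cp cm : ℝ} {H : ℝ → ℝ}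
    (hv : SplitRep m ν v cp cm H) {B : ℝ}
    (hB : ∀ x ∈ Icc (-ε) ε, |primitiveFn ν 0 H x| ≤ B) :
    ∫⁻ x, ENNReal.ofReal ((barrierFn ν H cp cm ε γ x - v x) ^ 2) ∂m ≤
      2 * (supMass ν ε * supMass m ε * ENNReal.ofReal (∫ t, H t ^ 2 ∂ν)) +
        ENNReal.ofReal ((2 * |cp - cm| + B) ^ 2) * m (Icc (-ε) ε) := by
  have := hν.locallyFinite
  have hP : ∀ c x, primitiveFn ν c H x = c + primitiveFn ν 0 H x := fun c x => by
    simp [primitiveFn]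
  -- Inside the barrier the interpolation is within |cp − cm| of `cm`; passing from `cm` to `cp` may
  -- cost |cp − cm| again, and the primitive of `H` costs `B`.
  set M := 2 * |cp - cm| + B
  have hcont : ∀ r, Measurable fun x =>
      ENNReal.ofReal ((∫ t in x + r..x + r + ε, H t ∂ν) ^ 2) := by
    intro r
    simp only [← primitiveFn_sub hv.memLp 0]
    have := continuous_primitiveFn hν hv.memLp 0
    exact Measurable.ennreal_ofReal (Continuous.measurable (by fun_prop))
  have hvp := (ae_restrict_iff' measurableSet_Ici).1 hv.ae_pos
  have hvm := (ae_restrict_iff' measurableSet_Iic).1 hv.ae_neg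
  -- To the right of the barrier the error is the increment of the primitive over [x − ε, x], to the
  -- left over [x, x + ε], and inside it is at most `M`.
  have hpt : ∀ᵐ x ∂m, ENNReal.ofReal ((barrierFn ν H cp cm ε γ x - v x) ^ 2) ≤
      ENNReal.ofReal ((∫ t in x + -ε..x + -ε + ε, H t ∂ν) ^ 2) +
      ENNReal.ofReal ((∫ t in x + 0..x + 0 + ε, H t ∂ν) ^ 2) +
      (Icc (-ε) ε).indicator (fun _ => ENNReal.ofReal (M ^ 2)) x := by
    filter_upwards [hvp, hvm] with x hxp hxm
    rcases le_or_gt ε x with h1 | h1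
    · rw [hxp (hε.le.trans h1), barrierFn_of_le hν hγ hε hv.measurable hv.memLp cp cm h1,
        add_assoc, ← neg_sq, neg_sub, primitiveFn_sub hv.memLp, neg_add_cancel_right,
        ← sub_eq_add_neg]
      exact le_self_add
    rcases le_or_gt x (-ε) with h2 | h2
    · rw [hxm (h2.trans (by simpa using hε.le)), barrierFn_of_le_neg hν hγ hε hv.measurable
        hv.memLp cp cm h2, primitiveFn_sub hv.memLp, add_zero]
      exact le_add_self.trans le_self_add
    · have hx : x ∈ Icc (-ε) ε := ⟨h2.le, h1.le⟩
      rw [indicator_of_mem hx]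
      refine le_trans (ENNReal.ofReal_le_ofReal ?_) le_add_self
      rw [← sq_abs]
      refine pow_le_pow_left₀ (abs_nonneg _) ?_ 2
      have h3 := abs_le.1 (abs_barrierFn_sub_le hν hγ hε hv.measurable hv.memLp cp cm hx)
      have h4 := abs_le.1 (hB x hx)
      have h5 := neg_abs_le (cp - cm)
      have h6 := le_abs_self (cp - cm)
      rcases le_total 0 x with h0 | h0
      · rw [hxp h0, hP, abs_le]
        constructor <;> linarith [h3.1, h3.2, h4.1, h4.2]
      · rw [hxm h0, hP, abs_le]
        constructor <;> linarith [h3.1, h3.2, h4.1, h4.2]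
  refine (lintegral_mono_ae hpt).trans ?_
  rw [lintegral_add_right _ (measurable_const.indicator measurableSet_Icc), lintegral_add_left (hcont _),
    lintegral_indicator_const measurableSet_Icc, two_mul]
  gcongr
  · exact lintegral_sq_increment_le hm hν hε hv.measurable hv.memLp _
  · exact lintegral_sq_increment_le hm hν hε hv.measurable hv.memLp _

end Recovery

/-! ### From energy bounds to Mosco convergence -/

section Mosco

/-- If the liminf were below the limiting energy, a finite `C` strictly between them would bound
infinitely many energies. Outside the limiting domain a constant sequence suffices for recovery. -/
theorem moscoConverges_of_energy_le {X : Type*} [NormedAddCommGroup X] [InnerProductSpace ℝ X]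
    {En : ℕ → SymForm X} {E : SymForm X}
    (hlow : ∀ (u : ℕ → X) (v : X),
      (∀ w : X, Tendsto (fun n => inner ℝ (u n) w) atTop (𝓝 (inner ℝ v w))) →
      ∀ C : ℝ, 0 ≤ C → (∃ᶠ n in atTop, (En n).energy (u n) ≤ ENNReal.ofReal C) →
        E.energy v ≤ ENNReal.ofReal C)
    (hup : ∀ v ∈ E.domain, ∃ u : ℕ → X, Tendsto u atTop (𝓝 v) ∧
      Tendsto (fun n => (En n).energy (u n)) atTop (𝓝 (E.energy v))) :
    MoscoConverges En E := by
  refine ⟨fun u v huv => ?_, fun v => ?_⟩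
  · by_contra! h
    obtain ⟨r, hr1, hr2⟩ := ENNReal.lt_iff_exists_nnreal_btwn.1 h
    have h1 := frequently_lt_of_liminf_lt (by isBoundedDefault) hr1
    have h2 := hlow u v huv r r.2 (h1.mono fun n hn => by
      rw [ENNReal.ofReal_coe_nnreal]; exact hn.le)
    rw [ENNReal.ofReal_coe_nnreal] at h2
    exact absurd h2 (not_le.2 hr2)
  · by_cases hv : v ∈ E.domain
    · obtain ⟨u, hu, hlim⟩ := hup v hv
      exact ⟨u, hu, hlim.limsup_eq.le⟩
    · refine ⟨fun _ => v, tendsto_const_nhds, ?_⟩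
      rw [SymForm.energy, if_neg hv]
      exact le_top

variable {m ν : Measure ℝ}

theorem exists_tendsto_of_splitRep (hm : IsAdmissible m) (hν : IsAdmissible ν) {ε : ℕ → ℝ}
    (hε : ∀ n, 0 < ε n) (hεa : Antitone ε) (hε0 : Tendsto ε atTop (𝓝 0)) {γ : ℕ → Measure ℝ}
    (hγ : ∀ n, IsBarrier (ε n) (γ n))
    (hsmall : Tendsto (fun n => supMass ν (ε n) * supMass m (ε n)) atTop (𝓝 0))
    {v : Lp ℝ 2 m} {cp cm : ℝ} {H : ℝ → ℝ} (hv : SplitRep m ν v cp cm H) {L : ℝ}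
    (hL : Tendsto (fun n => (cp - cm) ^ 2 / (γ n).real univ) atTop (𝓝 L)) :
    ∃ u : ℕ → Lp ℝ 2 m, Tendsto u atTop (𝓝 v) ∧
      Tendsto (fun n => (irreducibleForm m (barrierResistance ν (ε n) (γ n))).energy (u n)) atTop
        (𝓝 (ENNReal.ofReal (1 / 2 * (∫ x, H x ^ 2 ∂ν + L)))) := by
  have := hm.locallyFinite
  have := hm.isNullSingletonClass
  -- As the barriers shrink, a bound on the widest one serves for all `n`.
  obtain ⟨B, hB⟩ := (isCompact_Icc (a := -ε 0) (b := ε 0)).exists_bound_of_continuousOn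
    (continuous_primitiveFn hν hv.memLp 0).continuousOn
  set δ : ℕ → ℝ≥0∞ := fun n =>
    2 * (supMass ν (ε n) * supMass m (ε n) * ENNReal.ofReal (∫ t, H t ^ 2 ∂ν)) +
        ENNReal.ofReal ((2 * |cp - cm| + B) ^ 2) * m (Icc (-ε n) (ε n)) with hδ
  have hδ0 : Tendsto δ atTop (𝓝 0) := by
    have h1 : Tendsto (fun n => m (Icc (-ε n) (ε n))) atTop (𝓝 0) := by
      simpa [Function.comp_def] using (tendsto_measure_Icc m 0).comp hε0
    have h2 := ENNReal.Tendsto.const_mul (a := 2)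
      (ENNReal.Tendsto.mul_const (b := ENNReal.ofReal (∫ t, H t ^ 2 ∂ν)) hsmall
        (Or.inr ENNReal.ofReal_ne_top)) (Or.inr (by norm_num))
    have h3 := ENNReal.Tendsto.const_mul (a := ENNReal.ofReal ((2 * |cp - cm| + B) ^ 2)) h1
      (Or.inr ENNReal.ofReal_ne_top)
    simpa using h2.add h3
  have hbound : ∀ n, ∫⁻ x, ENNReal.ofReal ((barrierFn ν H cp cm (ε n) (γ n) x - v x) ^ 2) ∂m ≤
      δ n := fun n =>
    lintegral_sq_barrierFn_sub_le hm hν (hγ n) (hε n) hv fun x hx =>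
      hB x ⟨(neg_le_neg (hεa (Nat.zero_le n))).trans hx.1, hx.2.trans (hεa (Nat.zero_le n))⟩
  have hnorm : ∀ n, eLpNorm (fun x => barrierFn ν H cp cm (ε n) (γ n) x - v x) 2 m ≤
      δ n ^ (1 / 2 : ℝ) := by
    intro n
    rw [eLpNorm_eq_lintegral_rpow_enorm_toReal (by norm_num) (by norm_num), ENNReal.toReal_ofNat]
    refine ENNReal.rpow_le_rpow (le_trans (le_of_eq ?_) (hbound n)) (by norm_num)
    refine lintegral_congr fun x => ?_
    rw [Real.enorm_eq_ofReal_abs, ENNReal.ofReal_rpow_of_nonneg (abs_nonneg _) (by norm_num)]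
    norm_cast
    rw [sq_abs]
  -- The bound `δ n` may be infinite for small `n`, so membership of the interpolation in L² is
  -- available only eventually; the remaining terms of the sequence are arbitrary.
  have hex : ∀ᶠ n in atTop, ∃ f : Lp ℝ 2 m, edist f v ≤ δ n ^ (1 / 2 : ℝ) ∧
      f =ᵐ[m] barrierFn ν H cp cm (ε n) (γ n) := by
    filter_upwards [hδ0.eventually_lt_const ENNReal.zero_lt_top] with n hn
    have hcont : Continuous (barrierFn ν H cp cm (ε n) (γ n)) :=
      continuous_primitiveFn (hν.barrierResistance (hγ n))
        (memLp_barrierDensity (hγ n) (hε n) hv.measurable hv.memLp _) _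
    have hLp : MemLp (fun x => barrierFn ν H cp cm (ε n) (γ n) x - v x) 2 m :=
      ⟨hcont.aestronglyMeasurable.sub (Lp.aestronglyMeasurable v),
        (hnorm n).trans_lt (ENNReal.rpow_lt_top_of_nonneg (by norm_num) hn.ne)⟩
    have hLp' : MemLp (barrierFn ν H cp cm (ε n) (γ n)) 2 m := by
      refine (hLp.add (Lp.memLp v)).congr_norm hcont.aestronglyMeasurable (ae_of_all _ fun x => ?_)
      simp
    refine ⟨hLp'.toLp, ?_, hLp'.coeFn_toLp⟩
    rw [Lp.edist_def]
    refine le_trans (le_of_eq (eLpNorm_congr_ae ?_)) (hnorm n)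
    filter_upwards [hLp'.coeFn_toLp] with x hx
    rw [Pi.sub_apply, hx]
  obtain ⟨u, hu⟩ := hex.choice
  refine ⟨u, ?_, ?_⟩
  · rw [tendsto_iff_edist_tendsto_0]
    have h1 : Tendsto (fun n => δ n ^ (1 / 2 : ℝ)) atTop (𝓝 0) := by
      have := (ENNReal.continuous_rpow_const (y := 1 / 2)).tendsto 0 |>.comp hδ0
      simpa [Function.comp_def] using this
    exact tendsto_of_tendsto_of_tendsto_of_le_of_le' tendsto_const_nhds h1
      (Eventually.of_forall fun _ => zero_le) (hu.mono fun _ h => h.1)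
  · refine (ENNReal.tendsto_ofReal ((hL.const_add _).const_mul (1 / 2))).congr' ?_
    filter_upwards [hu] with n hn
    rw [(splitRep_barrierFn hν (hγ n) (hε n) hv hn.2).energy_irreducibleForm hm
      (hν.barrierResistance (hγ n)), integral_sq_barrierDensity (hγ n) (hε n) hv.measurable
      hv.memLp]

theorem IsBarrier.real_univ {ε : ℝ} {γ : Measure ℝ} (hγ : IsBarrier ε γ) :
    γ.real univ = (γ (Ioo (-ε) ε)).toReal := by
  have h : Ioo (-ε) ε =ᵐ[γ] univ := eventuallyEq_univ.2 hγ.null_compl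
  rw [measureReal_def, measure_congr h]

end Mosco

end StiffProblem

/-! ### The three regimes of the limiting barrier mass -/

theorem theorem4p5
    (m lam : Measure ℝ)
    (hm : StiffProblem.IsAdmissible m) (hlam : StiffProblem.IsAdmissible lam)
    (ε : ℕ → ℝ) (hε_pos : ∀ n, 0 < ε n) (hε_anti : Antitone ε)
    (hε_lim : Tendsto ε atTop (𝓝 0))
    (γ : ℕ → Measure ℝ) (hγ : ∀ n, StiffProblem.IsBarrier (ε n) (γ n))
    (h_small : Tendsto
      (fun n => γ n (Ioo (-ε n) (ε n)) * StiffProblem.supMass m (ε n)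
        + StiffProblem.supMass lam (ε n) * StiffProblem.supMass m (ε n)) atTop (𝓝 0))
    (γbar : ℝ≥0∞)
    (hγbar : Tendsto (fun n => γ n (Ioo (-ε n) (ε n))) atTop (𝓝 γbar)) :
    (γbar = ⊤ →
      StiffProblem.MoscoConverges
        (fun n => StiffProblem.irreducibleForm m
          (StiffProblem.barrierResistance lam (ε n) (γ n)))
        (StiffProblem.reflectingForm m lam)) ∧
    (0 < γbar → γbar < ⊤ →
      StiffProblem.MoscoConverges
        (fun n => StiffProblem.irreducibleForm m
          (StiffProblem.barrierResistance lam (ε n) (γ n)))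
        (StiffProblem.snappingOutForm m lam (2 / γbar.toReal) (by positivity))) ∧
    (γbar = 0 →
      StiffProblem.MoscoConverges
        (fun n => StiffProblem.irreducibleForm m
          (StiffProblem.barrierResistance lam (ε n) (γ n)))
        (StiffProblem.irreducibleForm m lam)) := by
  have h_mass : Tendsto (fun n => StiffProblem.supMass lam (ε n) * StiffProblem.supMass m (ε n))
      atTop (𝓝 0) :=
    tendsto_of_tendsto_of_tendsto_of_le_of_le tendsto_const_nhds h_small (fun _ => zero_le)
      (fun _ => le_add_self)
  refine ⟨fun htop => ?_, fun hpos hfin => ?_, fun hzero => ?_⟩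
  · refine StiffProblem.moscoConverges_of_energy_le (fun u v huv C hC hfreq => ?_) fun v hv => ?_
    · obtain ⟨cp, cm, H, hrep, hle, -⟩ :=
        StiffProblem.exists_splitRep_of_energy_le hm hlam hε_pos hε_lim hγ huv hfreq hC
      rw [hrep.energy_reflectingForm hm hlam]
      exact ENNReal.ofReal_le_ofReal (by linarith)
    · obtain ⟨cp, cm, H, hrep⟩ := StiffProblem.exists_splitRep_of_mem_reflectingForm hlam hv
      -- With infinite limiting resistance, an arbitrary jump is interpolated at vanishing energy
      -- cost.
      have hinv : Tendsto (fun n => (cp - cm) ^ 2 / (γ n).real univ) atTop (𝓝 0) := by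
        have h1 : Tendsto (fun n => (γ n (Ioo (-ε n) (ε n)))⁻¹) atTop (𝓝 0) := by
          rw [← ENNReal.inv_top, ← htop]
          exact hγbar.inv
        have h2 := ((ENNReal.tendsto_toReal ENNReal.zero_ne_top).comp h1).const_mul ((cp - cm) ^ 2)
        rw [ENNReal.toReal_zero, mul_zero] at h2
        refine h2.congr fun n => ?_
        rw [(hγ n).real_univ, Function.comp_apply, ENNReal.toReal_inv, div_eq_mul_inv]
      have h := StiffProblem.exists_tendsto_of_splitRep hm hlam hε_pos hε_anti hε_lim hγ h_mass
        hrep hinv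
      rwa [add_zero, ← hrep.energy_reflectingForm hm hlam] at h
  · have hg : 0 < γbar.toReal := ENNReal.toReal_pos hpos.ne' hfin.ne
    have hγ_real : Tendsto (fun n => (γ n).real univ) atTop (𝓝 γbar.toReal) :=
      ((ENNReal.tendsto_toReal hfin.ne).comp hγbar).congr fun n => (hγ n).real_univ.symm
    refine StiffProblem.moscoConverges_of_energy_le (fun u v huv C hC hfreq => ?_) fun v hv => ?_
    · obtain ⟨cp, cm, H, hrep, -, hjump⟩ :=
        StiffProblem.exists_splitRep_of_energy_le hm hlam hε_pos hε_lim hγ huv hfreq hC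
      rw [hrep.energy_snappingOutForm hm hlam]
      refine ENNReal.ofReal_le_ofReal ?_
      have h1 := hjump _ hγ_real
      rw [← div_le_iff₀' hg] at h1
      -- This is where κ = 2/γ̄ comes from: κ/4 is the factor ½ of the energy times 1/γ̄.
      have h2 : 2 / γbar.toReal / 4 * (cp - cm) ^ 2 = 1 / 2 * ((cp - cm) ^ 2 / γbar.toReal) := by
        ring
      rw [h2]
      linarith
    · obtain ⟨cp, cm, H, hrep⟩ := StiffProblem.exists_splitRep_of_mem_reflectingForm hlam hv
      have h := StiffProblem.exists_tendsto_of_splitRep hm hlam hε_pos hε_anti hε_lim hγ h_mass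
        hrep (tendsto_const_nhds.div hγ_real hg.ne')
      have h2 : 1 / 2 * (∫ x, H x ^ 2 ∂lam + (cp - cm) ^ 2 / γbar.toReal) =
          1 / 2 * ∫ x, H x ^ 2 ∂lam + 2 / γbar.toReal / 4 * (cp - cm) ^ 2 := by
        ring
      rwa [h2, ← hrep.energy_snappingOutForm hm hlam (by positivity)] at h
  · have hγ_real : Tendsto (fun n => (γ n).real univ) atTop (𝓝 0) := by
      rw [hzero] at hγbar
      exact ((ENNReal.tendsto_toReal ENNReal.zero_ne_top).comp hγbar).congr
        fun n => (hγ n).real_univ.symm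
    refine StiffProblem.moscoConverges_of_energy_le (fun u v huv C hC hfreq => ?_) fun v hv => ?_
    · obtain ⟨cp, cm, H, hrep, hle, hjump⟩ :=
        StiffProblem.exists_splitRep_of_energy_le hm hlam hε_pos hε_lim hγ huv hfreq hC
      have h1 := hjump _ hγ_real
      rw [zero_mul] at h1
      -- Zero limiting mass leaves no room for a jump, so the two halves join into one primitive on
      -- the line.
      obtain rfl : cp = cm := sub_eq_zero.1 (pow_eq_zero_iff two_ne_zero |>.1
        (le_antisymm h1 (sq_nonneg _)))
      rw [hrep.energy_irreducibleForm hm hlam]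
      exact ENNReal.ofReal_le_ofReal (by linarith)
    · obtain ⟨c, H, hrep⟩ := StiffProblem.exists_splitRep_of_mem_irreducibleForm hlam hv
      have h := StiffProblem.exists_tendsto_of_splitRep hm hlam hε_pos hε_anti hε_lim hγ h_mass
        hrep (L := 0) (by simp)
      rwa [add_zero, ← hrep.energy_irreducibleForm hm hlam] at h
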